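/- **Setting.** Let $M$ be a connected $n$-dimensional smooth manifold with a Finsler metric, i.e. a continuous function $F:TM\to\mathbb R$, smooth away from the zero section, with $F(x,y)>0$ for $y\neq0$, $F(x,\lambda y)=|\lambda|F(x,y)$ for $\lambda\in\mathbb R$, and with fundamental tensor $g_{ij}(x,y)=\frac12\frac{\partial^2F^2}{\partial y^i\partial y^j}(x,y)$ positive definite for $y\ne0$. For $y\in T_xM\setminus\{0\}$ write $g_y(u,v)=g_{ij}(x,y)u^iv^j$. With $(g^{ij})$ the inverse matrix of $(g_{ij})$, put $$\Gamma^i_{jk}=\tfrac12g^{im}\Big(\frac{\partial g_{mk}}{\partial x^j}+\frac{\partial g_{jm}}{\partial x^k}-\frac{\partial g_{jk}}{\partial x^m}\Big),\quad N^i_j=\tfrac12\frac{\partial}{\partial y^j}\big(\Gamma^i_{kl}y^ky^l\big),\quad \frac{\delta}{\delta x^i}=\frac{\partial}{\partial x^i}-N^j_i\frac{\partial}{\partial y^j},$$ $$L^i_{jk}=\tfrac12g^{im}\Big(\frac{\delta g_{mk}}{\delta x^j}+\frac{\delta g_{jm}}{\delta x^k}-\frac{\delta g_{jk}}{\delta x^m}\Big),\quad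 C^i_{jk}=\tfrac12g^{im}\Big(\frac{\partial g_{mk}}{\partial y^j}+\frac{\partial g_{jm}}{\partial y^k}-\frac{\partial g_{jk}}{\partial y^m}\Big)$$ (the Cartan connection). Along a regular curve $c$ the scalar product is $g(X,Y)(t)=g_{\dot c(t)}(X(t),Y(t))$, the norm is $\|X\|=\sqrt{g(X,X)}$, and the covariant derivative $\nabla X/dt$ has the components $$\frac{dX^i}{dt}+X^m\Big[L^i_{mk}(c,\dot c)\,\dot c^k+C^i_{mk}(c,\dot c)\big(\ddot c^k+N^k_l(c,\dot c)\dot c^l\big)\Big].$$ Let $x_0,x_1\in M$ and let $\Omega$ be the set of piecewise $C^\infty$ regular curves $c:[0,1]\to M$ from $x_0$ to $x_1$ (regular: no velocity, including the one-sided ones, vanishes). For real $p\neq0$ and $c\in\Omega$ let $E_p(c)=\int_0^1\|\dot c\|^p\,dt$. Let $(c_s)_{s\in(-\varepsilon,\varepsilon)}\subset\Omega$ be a one-parameter variation of $c=c_0\in\Omega$, i.e. there is a subdivision $0=t_0<\dots<t_k=1$ such that $(s,t)\mapsto c_s(t)$ is $C^\infty$ on each $(-\varepsilon,\varepsilon)\times[t_{i-1},t_i]$.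 Let $X(t)=\frac{\partial c_s}{\partial s}(t)\big|_{s=0}$ be its variation field. **Theorem (first variation of the $p$-energy).** The integrals below exist, the set $D\subset(0,1)$ of points at which $\dot c$ is discontinuous is finite, the function $s\mapsto E_p(c_s)$ is differentiable at $s=0$, and $$\frac1p\,\frac{dE_p(c_s)}{ds}\Big|_{s=0}=-\sum_{t\in D}g\big(X,\Delta_t(\|\dot c\|^{p-2}\dot c)\big)-\int_0^1\|\dot c\|^{p-4}\,g\Big(X,\ \|\dot c\|^2\frac{\nabla\dot c}{dt}+(p-2)\,g\Big(\frac{\nabla\dot c}{dt},\dot c\Big)\dot c\Big)\,dt .$$ Here $\Delta_t$ denotes the jump at $t$ (value at $t^+$ minus value at $t^-$), and each one-sided value is paired with $X$ by the scalar product along $c$ on its own side of $t$: $$g\big(X,\Delta_t(\|\dot c\|^{p-2}\dot c)\big)=g_{\dot c(t^+)}\big(X(t),\|\dot c(t^+)\|^{p-2}\dot c(t^+)\big)-g_{\dot c(t^-)}\big(X(t),\|\dot c(t^-)\|^{p-2}\dot c(t^-)\big),$$ where $\|\dot c(t^\pm)\|=\sqrt{g_{\dot c(t^\pm)}(\dot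 c(t^\pm),\dot c(t^\pm))}$. -/

import Mathlib

open Set MeasureTheory
open scoped Manifold ContDiff

noncomputable section

namespace FinslerVariation

/-! ### Local expressions: functions on an open part of `ℝⁿ × ℝⁿ`, with coordinates `(x, y)` -/

section Local

variable {n : ℕ}

/-- The partial derivative `∂h/∂xⁱ`. -/
def dX (i : Fin n) (h : EuclideanSpace ℝ (Fin n) × EuclideanSpace ℝ (Fin n) → ℝ)
    (z : EuclideanSpace ℝ (Fin n) × EuclideanSpace ℝ (Fin n)) : ℝ :=
  fderiv ℝ h z (EuclideanSpace.single i 1, 0)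

/-- The partial derivative `∂h/∂yⁱ`. -/
def dY (i : Fin n) (h : EuclideanSpace ℝ (Fin n) × EuclideanSpace ℝ (Fin n) → ℝ)
    (z : EuclideanSpace ℝ (Fin n) × EuclideanSpace ℝ (Fin n)) : ℝ :=
  fderiv ℝ h z (0, EuclideanSpace.single i 1)

variable (f : EuclideanSpace ℝ (Fin n) × EuclideanSpace ℝ (Fin n) → ℝ)

/-- The components `g_{ij} = ½ ∂²f²/∂yⁱ∂yʲ` of the fundamental tensor of `f`. -/
def gLow (i j : Fin n) (z : EuclideanSpace ℝ (Fin n) × EuclideanSpace ℝ (Fin n)) : ℝ :=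
  (1 / 2) * dY i (dY j (fun w => f w ^ 2)) z

/-- The inverse matrix `g^{ij}`. -/
def gUp (i j : Fin n) (z : EuclideanSpace ℝ (Fin n) × EuclideanSpace ℝ (Fin n)) : ℝ :=
  (Matrix.of fun a b : Fin n => gLow f a b z)⁻¹ i j

/-- The formal Christoffel symbols
`Γⁱ_{jk} = ½ g^{im} (∂g_{mk}/∂xʲ + ∂g_{jm}/∂xᵏ - ∂g_{jk}/∂xᵐ)`. -/
def christoffel (i j k : Fin n) (z : EuclideanSpace ℝ (Fin n) × EuclideanSpace ℝ (Fin n)) : ℝ :=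
  (1 / 2) * ∑ m, gUp f i m z *
    (dX j (gLow f m k) z + dX k (gLow f j m) z - dX m (gLow f j k) z)

/-- The nonlinear connection `Nⁱ_j = ½ ∂(Γⁱ_{kl} yᵏ yˡ)/∂yʲ`. -/
def nonlinConn (i j : Fin n) (z : EuclideanSpace ℝ (Fin n) × EuclideanSpace ℝ (Fin n)) : ℝ :=
  (1 / 2) * dY j (fun w => ∑ k, ∑ l, christoffel f i k l w * w.2 k * w.2 l) z

/-- The adapted derivative `δh/δxⁱ = ∂h/∂xⁱ - Nʲ_i ∂h/∂yʲ`. -/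
def deltaX (i : Fin n) (h : EuclideanSpace ℝ (Fin n) × EuclideanSpace ℝ (Fin n) → ℝ)
    (z : EuclideanSpace ℝ (Fin n) × EuclideanSpace ℝ (Fin n)) : ℝ :=
  dX i h z - ∑ j, nonlinConn f j i z * dY j h z

/-- The horizontal coefficients of the Cartan connection,
`Lⁱ_{jk} = ½ g^{im} (δg_{mk}/δxʲ + δg_{jm}/δxᵏ - δg_{jk}/δxᵐ)`. -/
def cartanL (i j k : Fin n) (z : EuclideanSpace ℝ (Fin n) × EuclideanSpace ℝ (Fin n)) : ℝ :=
  (1 / 2) * ∑ m, gUp f i m z *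
    (deltaX f j (gLow f m k) z + deltaX f k (gLow f j m) z - deltaX f m (gLow f j k) z)

/-- The vertical coefficients of the Cartan connection,
`Cⁱ_{jk} = ½ g^{im} (∂g_{mk}/∂yʲ + ∂g_{jm}/∂yᵏ - ∂g_{jk}/∂yᵐ)`. -/
def cartanC (i j k : Fin n) (z : EuclideanSpace ℝ (Fin n) × EuclideanSpace ℝ (Fin n)) : ℝ :=
  (1 / 2) * ∑ m, gUp f i m z *
    (dY j (gLow f m k) z + dY k (gLow f j m) z - dY m (gLow f j k) z)

/-- The coordinate expression of the Cartan covariant derivative along a curve `x(t)` of a vector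
field with components `X(t)`:
`dXⁱ/dt + Xᵐ (Lⁱ_{mk}(x, ẋ) ẋᵏ + Cⁱ_{mk}(x, ẋ) δẋᵏ/dt)` with `δẋᵏ/dt = ẍᵏ + Nᵏ_l(x, ẋ) ẋˡ`. -/
def covDerivLocal (x X : ℝ → EuclideanSpace ℝ (Fin n)) (t : ℝ) : EuclideanSpace ℝ (Fin n) :=
  WithLp.toLp 2 fun i =>
    deriv X t i + ∑ m, X t m * ∑ k,
      (cartanL f i m k (x t, deriv x t) * deriv x t k
        + cartanC f i m k (x t, deriv x t) *
          (deriv (deriv x) t k + ∑ l, nonlinConn f k l (x t, deriv x t) * deriv x t l))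

end Local

/-! ### Finsler metrics -/

section Global

variable {n : ℕ} {M : Type*} [TopologicalSpace M] [ChartedSpace (EuclideanSpace ℝ (Fin n)) M]

/-- The fundamental tensor at `y ∈ T_xM` of a function `F` on `TM`,
`g_{(x,y)}(u, v) = ½ ∂²/∂a∂b F²(x, y + a u + b v)` at `a = b = 0`, which is
`g_{ij}(x, y) uⁱ vʲ` with `g_{ij} = ½ ∂²F²/∂yⁱ∂yʲ`. -/
def fundTensor (F : TangentBundle (𝓡 n) M → ℝ) (x : M) (y u v : TangentSpace (𝓡 n) x) : ℝ :=
  (1 / 2) * deriv (fun a : ℝ => deriv (fun b : ℝ => F ⟨x, y + a • u + b • v⟩ ^ 2) 0) 0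

variable (n M) in
/-- A (reversible) Finsler metric on `M`. -/
structure FinslerMetric [IsManifold (𝓡 n) ∞ M] where
  /-- The fundamental function on the tangent bundle. -/
  F : TangentBundle (𝓡 n) M → ℝ
  pos : ∀ (x : M) (y : TangentSpace (𝓡 n) x), y ≠ 0 → 0 < F ⟨x, y⟩
  homogeneous : ∀ (x : M) (r : ℝ) (y : TangentSpace (𝓡 n) x), F ⟨x, r • y⟩ = |r| * F ⟨x, y⟩
  posDef : ∀ (x : M) (y : TangentSpace (𝓡 n) x), y ≠ 0 →
    ∀ u : TangentSpace (𝓡 n) x, u ≠ 0 → 0 < fundTensor F x y u u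
  smooth : ContMDiffOn (𝓡 n).tangent 𝓘(ℝ, ℝ) ∞ F {v : TangentBundle (𝓡 n) M | v.2 ≠ 0}
  continuous : Continuous F

/-- The velocity `ċ(t)`. -/
def velocity (c : ℝ → M) (t : ℝ) : TangentSpace (𝓡 n) (c t) :=
  mfderiv 𝓘(ℝ, ℝ) (𝓡 n) c t (1 : ℝ)

/-- The one-sided velocity of `c` at `t`, relative to a set `s` of parameters. -/
def velocityWithin (c : ℝ → M) (s : Set ℝ) (t : ℝ) : TangentSpace (𝓡 n) (c t) :=
  mfderivWithin 𝓘(ℝ, ℝ) (𝓡 n) c s t (1 : ℝ)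

/-- The set `Ω` of piecewise smooth regular curves `[0,1] → M` from `x₀` to `x₁`. Only the values
of `c` on `[0,1]` matter; `S` is a finite set of parameters in `(0,1)` such that `c` is smooth and
regular, up to the end points, on each closed subinterval of `[0,1]` without a point of `S` in its
interior. -/
def IsAdmissible (n : ℕ) {M : Type*} [TopologicalSpace M]
    [ChartedSpace (EuclideanSpace ℝ (Fin n)) M] (x₀ x₁ : M) (c : ℝ → M) : Prop :=
  c 0 = x₀ ∧ c 1 = x₁ ∧ ∃ S : Finset ℝ, (S : Set ℝ) ⊆ Ioo 0 1 ∧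
    ∀ a b : ℝ, 0 ≤ a → a < b → b ≤ 1 → Disjoint (Ioo a b) (S : Set ℝ) →
      ContMDiffOn 𝓘(ℝ, ℝ) (𝓡 n) ∞ c (Icc a b) ∧
      ∀ t ∈ Icc a b, velocityWithin (n := n) c (Icc a b) t ≠ 0

/-- `s ↦ Γ s`, `|s| < ε`, is a one-parameter variation of `Γ 0` in `Ω`: all the curves `Γ s` are
in `Ω`, and for a finite set of parameters in `(0,1)` the map `(s, t) ↦ Γ s t` is smooth on
`(-ε, ε) × [a, b]` for each `[a, b] ⊆ [0,1]` without a point of that set in its interior. -/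
def IsVariation (n : ℕ) {M : Type*} [TopologicalSpace M]
    [ChartedSpace (EuclideanSpace ℝ (Fin n)) M] (x₀ x₁ : M) (ε : ℝ) (Γ : ℝ → ℝ → M) : Prop :=
  (∀ s ∈ Ioo (-ε) ε, IsAdmissible n x₀ x₁ (Γ s)) ∧
  ∃ S : Finset ℝ, (S : Set ℝ) ⊆ Ioo 0 1 ∧
    ∀ a b : ℝ, 0 ≤ a → a < b → b ≤ 1 → Disjoint (Ioo a b) (S : Set ℝ) →
      ContMDiffOn 𝓘(ℝ, ℝ × ℝ) (𝓡 n) ∞ (fun q : ℝ × ℝ => Γ q.1 q.2) (Ioo (-ε) ε ×ˢ Icc a b)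

/-- The variation field `X(t) = ∂c_s(t)/∂s` at `s = 0`, for `c_s = Γ s`. -/
def variationField (Γ : ℝ → ℝ → M) (t : ℝ) : TangentSpace (𝓡 n) (Γ 0 t) :=
  mfderiv 𝓘(ℝ, ℝ) (𝓡 n) (fun s => Γ s t) 0 (1 : ℝ)

/-- The interior parameters at which `ċ` is discontinuous. -/
def breakPoints (n : ℕ) {M : Type*} [TopologicalSpace M]
    [ChartedSpace (EuclideanSpace ℝ (Fin n)) M] (c : ℝ → M) : Set ℝ :=
  {t ∈ Ioo (0 : ℝ) 1 | velocityWithin (n := n) c (Ici t) t ≠ velocityWithin (n := n) c (Iic t) t}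

variable [IsManifold (𝓡 n) ∞ M]

namespace FinslerMetric

variable (𝓕 : FinslerMetric n M)

/-- The scalar product `g_{(x,y)}(u, v) = g_{ij}(x, y) uⁱ vʲ` on `T_xM`, with reference vector
`y`. -/
def g {x : M} (y u v : TangentSpace (𝓡 n) x) : ℝ := fundTensor 𝓕.F x y u v

/-- The norm `‖u‖ = √g(u, u)`, with reference vector `y`. -/
def nrm {x : M} (y u : TangentSpace (𝓡 n) x) : ℝ := √(𝓕.g y u u)

/-- The `p`-energy `∫₀¹ ‖ċ‖ᵖ dt`. -/
def energy (p : ℝ) (c : ℝ → M) : ℝ :=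
  ∫ t in (0 : ℝ)..1, 𝓕.nrm (velocity c t) (velocity c t) ^ p

/-- The expression `f(x, y)` of the fundamental function in the coordinates of `TM` that are
induced by the preferred chart at `x₀`. -/
def localF (x₀ : M) (z : EuclideanSpace ℝ (Fin n) × EuclideanSpace ℝ (Fin n)) : ℝ :=
  𝓕.F ⟨(extChartAt (𝓡 n) x₀).symm z.1,
    (trivializationAt (EuclideanSpace ℝ (Fin n)) (TangentSpace (𝓡 n)) x₀).symm
      ((extChartAt (𝓡 n) x₀).symm z.1) z.2⟩

/-- The covariant derivative `∇X/dt` along `c` that is induced by the Cartan connection; it is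
computed at the parameter `t` in the chart at `c t`, and the resulting components are taken with
respect to the coordinate basis `∂/∂xⁱ` of `T_{c(t)}M`. -/
def covDeriv (c : ℝ → M) (X : ∀ t, TangentSpace (𝓡 n) (c t)) (t : ℝ) :
    TangentSpace (𝓡 n) (c t) :=
  (trivializationAt (EuclideanSpace ℝ (Fin n)) (TangentSpace (𝓡 n)) (c t)).symm (c t)
    (covDerivLocal (𝓕.localF (c t)) (fun τ => extChartAt (𝓡 n) (c t) (c τ))
      (fun τ => (trivializationAt (EuclideanSpace ℝ (Fin n)) (TangentSpace (𝓡 n)) (c t)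
        (⟨c τ, X τ⟩ : TangentBundle (𝓡 n) M)).2) t)

/-- `g(X, ‖ċ‖^{p-2} ċ)` for a given value `y` of `ċ` at the parameter considered. -/
def momentum (p : ℝ) {x : M} (y u : TangentSpace (𝓡 n) x) : ℝ :=
  𝓕.g y u (𝓕.nrm y y ^ (p - 2) • y)

/-- The term `g(u, Δ_t(‖ċ‖^{p-2} ċ))`, where each of the one-sided values of `‖ċ‖^{p-2} ċ` is
paired with `u` by the scalar product along the curve on its own side of `t`. -/
def jump (p : ℝ) (c : ℝ → M) (t : ℝ) (u : TangentSpace (𝓡 n) (c t)) : ℝ :=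
  𝓕.momentum p (velocityWithin c (Ici t) t) u - 𝓕.momentum p (velocityWithin c (Iic t) t) u

/-- The integrand `‖ċ‖^{p-4} g(u, ‖ċ‖² ∇ċ/dt + (p - 2) g(∇ċ/dt, ċ) ċ)`. -/
def variationIntegrand (p : ℝ) (c : ℝ → M) (t : ℝ) (u : TangentSpace (𝓡 n) (c t)) : ℝ :=
  𝓕.nrm (velocity c t) (velocity c t) ^ (p - 4) *
    𝓕.g (velocity c t) u
      (𝓕.nrm (velocity c t) (velocity c t) ^ 2 • 𝓕.covDeriv c (velocity c) t
        + ((p - 2) * 𝓕.g (velocity c t) (𝓕.covDeriv c (velocity c) t) (velocity c t)) •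
          velocity c t)

end FinslerMetric

end Global

end FinslerVariation

end

/-! Euler's relation for the homogeneous function F gives g_y(y, y) = F(x, y)², so along regular
curves ‖ċ‖ = F(ċ) and the p-energy is the action of the Lagrangian F^p. Put m = F^(p-2) g_ċ(X, ċ);
then p m is the fibre derivative of F^p at ċ in the direction X, i.e. the Legendre momentum of F^p
paired with X. Let J be the integrand of the theorem. The core is the Euler–Lagrange identity d(p
m)/dt = ∂F^p/∂s + p J inside each smooth piece (`hasDerivAt_momentum_local` in coordinates,
`FinslerMetric.hasDerivAt_momentum` on the manifold). Differentiating the energy under the integral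
sign and integrating this identity leaves the values of m at the ends of the pieces
(`hasDerivAt_integral_of_hasDerivAt_momentum`). When pieces are joined these combine into the jumps,
and at 0 and 1 they vanish because X does.

The Cartan connection enters only through ∇ċ/dt. The components g_ij have degree 0 in y, so
contraction with y annihilates C and every term of L that contains N. Lowering the index of ∇ċ/dt
then yields ½ (d/dt ∂f²/∂y - ∂f²/∂x), whatever N is (`sum_gLow_mul_covDerivLocal`). Pairing this
with ċ gives g(∇ċ/dt, ċ) = F dF/dt, the source of the term with p - 2.

Two points need care. At the ends of a piece only one-sided derivatives are available, so the
smoothness of m up to the ends comes from writing p m as a derivative of F^p composed with a tangent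
map (`FinslerMetric.contDiffOn_momentum`); this also makes J integrable. Moreover each curve of the
variation has its own break points, so regularity has to be transferred to the common subdivision
(`IsAdmissible.mfderivWithin_ne_zero`). -/

namespace FinslerVariation

/-! ### Partial derivatives in coordinates and homogeneity of the fundamental tensor -/

section LocalCalculus

variable {n : ℕ}

theorem contDiffOn_fderiv_apply {φ : EuclideanSpace ℝ (Fin n) × EuclideanSpace ℝ (Fin n) → ℝ}
    {W : Set (EuclideanSpace ℝ (Fin n) × EuclideanSpace ℝ (Fin n))} (hW : IsOpen W)
    (hφ : ContDiffOn ℝ ∞ φ W) (v : EuclideanSpace ℝ (Fin n) × EuclideanSpace ℝ (Fin n)) :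
      ContDiffOn ℝ ∞ (fun w => fderiv ℝ φ w v) W :=
  (hφ.fderiv_of_isOpen hW (by simp)).clm_apply contDiffOn_const

theorem contDiffOn_dY {φ : EuclideanSpace ℝ (Fin n) × EuclideanSpace ℝ (Fin n) → ℝ}
    {W : Set (EuclideanSpace ℝ (Fin n) × EuclideanSpace ℝ (Fin n))} (hW : IsOpen W)
    (hφ : ContDiffOn ℝ ∞ φ W) (i : Fin n) : ContDiffOn ℝ ∞ (dY i φ) W :=
  contDiffOn_fderiv_apply hW hφ _

theorem contDiffOn_differentiableAt {φ : EuclideanSpace ℝ (Fin n) × EuclideanSpace ℝ (Fin n) → ℝ}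
    {W : Set (EuclideanSpace ℝ (Fin n) × EuclideanSpace ℝ (Fin n))} (hW : IsOpen W)
    (hφ : ContDiffOn ℝ ∞ φ W) {z : EuclideanSpace ℝ (Fin n) × EuclideanSpace ℝ (Fin n)}
      (hz : z ∈ W) : DifferentiableAt ℝ φ z :=
  (hφ.contDiffAt (hW.mem_nhds hz)).differentiableAt (by simp)

theorem fderiv_fderiv_apply_comm {G : Type*} [NormedAddCommGroup G] [NormedSpace ℝ G]
    {E' : Type*} [NormedAddCommGroup E'] [NormedSpace ℝ E']
    {φ : E' → G} {z : E'} (hφ : ContDiffAt ℝ ∞ φ z) (u v : E') :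
    fderiv ℝ (fun w => fderiv ℝ φ w u) z v = fderiv ℝ (fun w => fderiv ℝ φ w v) z u := by
  have hd : DifferentiableAt ℝ (fderiv ℝ φ) z :=
    (hφ.fderiv_right (m := 1) (by norm_cast)).differentiableAt (by simp)
  have key : ∀ a b : E', fderiv ℝ (fun w => fderiv ℝ φ w a) z b = fderiv ℝ (fderiv ℝ φ) z b a := by
    intro a b
    rw [fderiv_clm_apply hd (differentiableAt_const a)]
    simp
  rw [key, key]
  exact (hφ.isSymmSndFDerivAt (by simp; norm_cast)).eq v u

theorem dY_comm {φ : EuclideanSpace ℝ (Fin n) × EuclideanSpace ℝ (Fin n) → ℝ}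
    {W : Set (EuclideanSpace ℝ (Fin n) × EuclideanSpace ℝ (Fin n))} (hW : IsOpen W)
    (hφ : ContDiffOn ℝ ∞ φ W) {z : EuclideanSpace ℝ (Fin n) × EuclideanSpace ℝ (Fin n)}
      (hz : z ∈ W) (i j : Fin n) :
    dY i (dY j φ) z = dY j (dY i φ) z :=
  fderiv_fderiv_apply_comm (hφ.contDiffAt (hW.mem_nhds hz)) _ _

theorem clm_apply_eq_sum (T : EuclideanSpace ℝ (Fin n) × EuclideanSpace ℝ (Fin n) →L[ℝ] ℝ)
    (a b : EuclideanSpace ℝ (Fin n)) :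
    T (a, b) = ∑ i, a i * T (EuclideanSpace.single i 1, 0)
      + ∑ i, b i * T (0, EuclideanSpace.single i 1) := by
  have hs : ∀ c : EuclideanSpace ℝ (Fin n), c = ∑ i, c i •
      (EuclideanSpace.single i (1 : ℝ) : EuclideanSpace ℝ (Fin n)) := by
    intro c
    ext j
    simp [Finset.sum_apply, Pi.single_apply]
  have h1 : T (a, 0) = ∑ i, a i * T (EuclideanSpace.single i 1, 0) := by
    have : T (a, 0) =
      (T.comp (ContinuousLinearMap.inl ℝ (EuclideanSpace ℝ (Fin n)) (EuclideanSpace ℝ (Fin n)))) a := by simp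
    rw [this]
    conv_lhs => rw [hs a]
    simp [map_sum]
  have h2 : T (0, b) = ∑ i, b i * T (0, EuclideanSpace.single i 1) := by
    have : T (0, b) =
      (T.comp (ContinuousLinearMap.inr ℝ (EuclideanSpace ℝ (Fin n)) (EuclideanSpace ℝ (Fin n)))) b := by simp
    rw [this]
    conv_lhs => rw [hs b]
    simp [map_sum]
  rw [← h1, ← h2, ← map_add]
  simp

theorem fderiv_eq_sum (φ : EuclideanSpace ℝ (Fin n) × EuclideanSpace ℝ (Fin n) → ℝ)
    (z : EuclideanSpace ℝ (Fin n) × EuclideanSpace ℝ (Fin n)) (a b : EuclideanSpace ℝ (Fin n)) :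
    fderiv ℝ φ z (a, b) = ∑ i, a i * dX i φ z + ∑ i, b i * dY i φ z :=
  clm_apply_eq_sum _ _ _

/-- The product rule for a contraction with y. It serves to differentiate Euler's relations once
more. -/
theorem fderiv_sum_snd_mul {ψ : Fin n → EuclideanSpace ℝ (Fin n) × EuclideanSpace ℝ (Fin n) → ℝ}
    {z : EuclideanSpace ℝ (Fin n) × EuclideanSpace ℝ (Fin n)}
    (hψ : ∀ j, DifferentiableAt ℝ (ψ j) z)
      (v : EuclideanSpace ℝ (Fin n) × EuclideanSpace ℝ (Fin n)) :
    fderiv ℝ (fun w : EuclideanSpace ℝ (Fin n) × EuclideanSpace ℝ (Fin n) => ∑ j, w.2 j * ψ j w) z v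
      = ∑ j, z.2 j * fderiv ℝ (ψ j) z v + ∑ j, v.2 j * ψ j z := by
  have hc : ∀ j, HasFDerivAt (fun w : EuclideanSpace ℝ (Fin n) × EuclideanSpace ℝ (Fin n) => w.2 j)
      ((EuclideanSpace.proj j : EuclideanSpace ℝ (Fin n) →L[ℝ] ℝ).comp (ContinuousLinearMap.snd ℝ (EuclideanSpace ℝ (Fin n)) (EuclideanSpace ℝ (Fin n)))) z := fun j =>
    ((EuclideanSpace.proj j : EuclideanSpace ℝ (Fin n) →L[ℝ] ℝ).comp (ContinuousLinearMap.snd ℝ (EuclideanSpace ℝ (Fin n)) (EuclideanSpace ℝ (Fin n)))).hasFDerivAt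
  have := HasFDerivAt.fun_sum (u := Finset.univ) fun j _ => (hc j).mul (hψ j).hasFDerivAt
  refine (congrArg (fun T => T v) this.fderiv).trans ?_
  simp [Finset.sum_add_distrib, mul_comm]

/-! ### Euler's relations -/

variable {f : EuclideanSpace ℝ (Fin n) × EuclideanSpace ℝ (Fin n) → ℝ}
    {W : Set (EuclideanSpace ℝ (Fin n) × EuclideanSpace ℝ (Fin n))}

/-- Differentiate f(x, r y)² = r² f(x, y)² at r = 1; squaring removes the absolute value. -/
theorem sum_snd_mul_dY_sq (hW : IsOpen W) (hf : ContDiffOn ℝ ∞ f W)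
    (hom : ∀ x y (r : ℝ), (x, y) ∈ W → f (x, r • y) = |r| * f (x, y))
      {z : EuclideanSpace ℝ (Fin n) × EuclideanSpace ℝ (Fin n)} (hz : z ∈ W) :
    ∑ j, z.2 j * dY j (fun w => f w ^ 2) z = 2 * f z ^ 2 := by
  have h1 : HasDerivAt (fun r : ℝ => f (z.1, r • z.2) ^ 2)
      (fderiv ℝ (fun w => f w ^ 2) z (0, z.2)) 1 := by
    have hg : HasFDerivAt (fun w => f w ^ 2) (fderiv ℝ (fun w => f w ^ 2) z)
        (z.1, (1 : ℝ) • z.2) := by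
      simpa using (contDiffOn_differentiableAt hW (hf.pow 2) hz).hasFDerivAt
    have hl : HasDerivAt (fun r : ℝ => (z.1, r • z.2)) (0, (1 : ℝ) • z.2) 1 :=
      (hasDerivAt_const _ _).prodMk ((hasDerivAt_id (1 : ℝ)).smul_const z.2)
    rw [one_smul] at hl
    exact hg.comp_hasDerivAt (1 : ℝ) hl
  have h2 : HasDerivAt (fun r : ℝ => f (z.1, r • z.2) ^ 2) (2 * f z ^ 2) 1 := by
    have : (fun r : ℝ => f (z.1, r • z.2) ^ 2) = fun r : ℝ => r ^ 2 * f z ^ 2 := by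
      ext r
      rw [hom _ _ _ hz, mul_pow, sq_abs]
    rw [this]
    simpa using (hasDerivAt_pow 2 (1 : ℝ)).mul_const (f z ^ 2)
  have := h1.unique h2
  rw [fderiv_eq_sum] at this
  simpa using this

/-- Euler's relation holds on an open set, so it may be differentiated in an arbitrary direction v,
horizontal or vertical. -/
theorem sum_snd_mul_fderiv_dY_sq (hW : IsOpen W) (hf : ContDiffOn ℝ ∞ f W)
    (hom : ∀ x y (r : ℝ), (x, y) ∈ W → f (x, r • y) = |r| * f (x, y))
      {z : EuclideanSpace ℝ (Fin n) × EuclideanSpace ℝ (Fin n)} (hz : z ∈ W)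
    (v : EuclideanSpace ℝ (Fin n) × EuclideanSpace ℝ (Fin n)) :
    ∑ j, z.2 j * fderiv ℝ (dY j (fun w => f w ^ 2)) z v
        + ∑ j, v.2 j * dY j (fun w => f w ^ 2) z
      = 2 * fderiv ℝ (fun w => f w ^ 2) z v := by
  have h := hf.pow 2
  rw [← fderiv_sum_snd_mul fun j => contDiffOn_differentiableAt hW (contDiffOn_dY hW h j) hz]
  have he :
      (fun w : EuclideanSpace ℝ (Fin n) × EuclideanSpace ℝ (Fin n) => ∑ j, w.2 j * dY j (fun w => f w ^ 2) w)
      =ᶠ[nhds z] fun w => 2 * f w ^ 2 := by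
    filter_upwards [hW.mem_nhds hz] with w hw using sum_snd_mul_dY_sq hW hf hom hw
  rw [he.fderiv_eq, fderiv_const_mul (contDiffOn_differentiableAt hW h hz)]
  simp

theorem contDiffOn_gLow (hW : IsOpen W) (hf : ContDiffOn ℝ ∞ f W) (i j : Fin n) :
    ContDiffOn ℝ ∞ (gLow f i j) W :=
  contDiffOn_const.mul (contDiffOn_dY hW (contDiffOn_dY hW (hf.pow 2) j) i)

theorem gLow_symm (hW : IsOpen W) (hf : ContDiffOn ℝ ∞ f W)
    {z : EuclideanSpace ℝ (Fin n) × EuclideanSpace ℝ (Fin n)} (hz : z ∈ W)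
    (i j : Fin n) : gLow f i j z = gLow f j i z := by
  rw [gLow, gLow, dY_comm hW (hf.pow 2) hz]

theorem sum_snd_mul_gLow (hW : IsOpen W) (hf : ContDiffOn ℝ ∞ f W)
    (hom : ∀ x y (r : ℝ), (x, y) ∈ W → f (x, r • y) = |r| * f (x, y))
      {z : EuclideanSpace ℝ (Fin n) × EuclideanSpace ℝ (Fin n)} (hz : z ∈ W)
    (i : Fin n) :
    ∑ j, z.2 j * gLow f i j z = 1 / 2 * dY i (fun w => f w ^ 2) z := by
  have h := sum_snd_mul_fderiv_dY_sq hW hf hom hz (0, EuclideanSpace.single i 1)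
  have h3 : ∑ j, z.2 j * gLow f i j z = 1 / 2 *
      ∑ j, z.2 j * fderiv ℝ (dY j (fun w => f w ^ 2)) z (0, EuclideanSpace.single i 1) := by
    rw [Finset.mul_sum]
    refine Finset.sum_congr rfl fun j _ => ?_
    rw [gLow, dY]
    ring
  have h4 : ∑ j,
      ((0 : EuclideanSpace ℝ (Fin n)), (EuclideanSpace.single i 1 : EuclideanSpace ℝ (Fin n))).2 j * dY j (fun w => f w ^ 2) z
      = dY i (fun w => f w ^ 2) z := by
    simp
  rw [h4] at h
  rw [h3, show fderiv ℝ (fun w => f w ^ 2) z (0, EuclideanSpace.single i 1)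
    = dY i (fun w => f w ^ 2) z from rfl] at *
  linarith

theorem sum_snd_mul_fderiv_gLow (hW : IsOpen W) (hf : ContDiffOn ℝ ∞ f W)
    (hom : ∀ x y (r : ℝ), (x, y) ∈ W → f (x, r • y) = |r| * f (x, y))
      {z : EuclideanSpace ℝ (Fin n) × EuclideanSpace ℝ (Fin n)} (hz : z ∈ W)
    (i : Fin n) (v : EuclideanSpace ℝ (Fin n) × EuclideanSpace ℝ (Fin n)) :
    ∑ j, z.2 j * fderiv ℝ (gLow f i j) z v + ∑ j, v.2 j * gLow f i j z
      = 1 / 2 * fderiv ℝ (dY i (fun w => f w ^ 2)) z v := by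
  rw [← fderiv_sum_snd_mul fun j => contDiffOn_differentiableAt hW (contDiffOn_gLow hW hf i j) hz]
  have he :
      (fun w : EuclideanSpace ℝ (Fin n) × EuclideanSpace ℝ (Fin n) => ∑ j, w.2 j * gLow f i j w)
      =ᶠ[nhds z] fun w => 1 / 2 * dY i (fun w => f w ^ 2) w := by
    filter_upwards [hW.mem_nhds hz] with w hw using sum_snd_mul_gLow hW hf hom hw i
  rw [he.fderiv_eq, fderiv_const_mul
    (contDiffOn_differentiableAt hW (contDiffOn_dY hW (hf.pow 2) i) hz)]
  simp

theorem sum_snd_mul_dX_gLow (hW : IsOpen W) (hf : ContDiffOn ℝ ∞ f W)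
    (hom : ∀ x y (r : ℝ), (x, y) ∈ W → f (x, r • y) = |r| * f (x, y))
      {z : EuclideanSpace ℝ (Fin n) × EuclideanSpace ℝ (Fin n)} (hz : z ∈ W)
    (i k : Fin n) :
    ∑ j, z.2 j * dX k (gLow f i j) z = 1 / 2 * dX k (dY i (fun w => f w ^ 2)) z := by
  simpa [dX] using sum_snd_mul_fderiv_gLow hW hf hom hz i (EuclideanSpace.single k 1, 0)

/-- This is the degree-0 homogeneity of the fundamental tensor: in the vertical derivative of g_ij
yʲ = ½ ∂f²/∂yⁱ the two undifferentiated terms g_ik cancel. It is what removes C and N later. -/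
theorem sum_snd_mul_dY_gLow (hW : IsOpen W) (hf : ContDiffOn ℝ ∞ f W)
    (hom : ∀ x y (r : ℝ), (x, y) ∈ W → f (x, r • y) = |r| * f (x, y))
      {z : EuclideanSpace ℝ (Fin n) × EuclideanSpace ℝ (Fin n)} (hz : z ∈ W)
    (i k : Fin n) :
    ∑ j, z.2 j * dY k (gLow f i j) z = 0 := by
  have h := sum_snd_mul_fderiv_gLow hW hf hom hz i (0, EuclideanSpace.single k 1)
  have h4 : ∑ j,
      ((0 : EuclideanSpace ℝ (Fin n)), (EuclideanSpace.single k 1 : EuclideanSpace ℝ (Fin n))).2 j * gLow f i j z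
      = gLow f i k z := by
    simp
  rw [h4, show 1 / 2 * fderiv ℝ (dY i (fun w => f w ^ 2)) z (0, EuclideanSpace.single k 1)
    = gLow f k i z from rfl, gLow_symm hW hf hz k i] at h
  simpa [dY] using h

/-- Up to the factor ½ these are third y-derivatives of f², hence totally symmetric. -/
theorem dY_gLow_symm (hW : IsOpen W) (hf : ContDiffOn ℝ ∞ f W)
    {z : EuclideanSpace ℝ (Fin n) × EuclideanSpace ℝ (Fin n)} (hz : z ∈ W)
    (i j k : Fin n) : dY k (gLow f i j) z = dY i (gLow f k j) z := by
  have hd : ∀ a b c, dY c (gLow f a b) z = 1 / 2 * dY c (dY a (dY b (fun w => f w ^ 2))) z := by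
    intro a b c
    have := fderiv_const_mul (contDiffOn_differentiableAt hW
      (contDiffOn_dY hW (contDiffOn_dY hW (hf.pow 2) b) a) hz) (1 / 2 : ℝ)
    unfold dY at this ⊢
    unfold gLow
    unfold dY
    rw [this]
    simp
  rw [hd, hd, dY_comm hW (contDiffOn_dY hW (hf.pow 2) j) hz]

theorem dirDeriv_gLow_symm (hW : IsOpen W) (hf : ContDiffOn ℝ ∞ f W)
    {z : EuclideanSpace ℝ (Fin n) × EuclideanSpace ℝ (Fin n)} (hz : z ∈ W)
    (i j : Fin n) : fderiv ℝ (gLow f i j) z = fderiv ℝ (gLow f j i) z := by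
  refine Filter.EventuallyEq.fderiv_eq ?_
  filter_upwards [hW.mem_nhds hz] with w hw using gLow_symm hW hf hw i j

theorem dY_gLow_symm' (hW : IsOpen W) (hf : ContDiffOn ℝ ∞ f W)
    {z : EuclideanSpace ℝ (Fin n) × EuclideanSpace ℝ (Fin n)} (hz : z ∈ W)
    (i j k : Fin n) : dY k (gLow f i j) z = dY k (gLow f j i) z := by
  rw [dY, dirDeriv_gLow_symm hW hf hz i j, dY]

theorem dX_gLow_symm (hW : IsOpen W) (hf : ContDiffOn ℝ ∞ f W)
    {z : EuclideanSpace ℝ (Fin n) × EuclideanSpace ℝ (Fin n)} (hz : z ∈ W)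
    (i j k : Fin n) : dX k (gLow f i j) z = dX k (gLow f j i) z := by
  rw [dX, dirDeriv_gLow_symm hW hf hz i j, dX]

theorem sum_sum_dX_gLow (hW : IsOpen W) (hf : ContDiffOn ℝ ∞ f W)
    (hom : ∀ x y (r : ℝ), (x, y) ∈ W → f (x, r • y) = |r| * f (x, y))
      {z : EuclideanSpace ℝ (Fin n) × EuclideanSpace ℝ (Fin n)} (hz : z ∈ W)
    (k : Fin n) :
    ∑ i, z.2 i * ∑ j, z.2 j * dX k (gLow f i j) z = dX k (fun w => f w ^ 2) z := by
  have h := sum_snd_mul_fderiv_dY_sq hW hf hom hz (EuclideanSpace.single k 1, 0)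
  simp only [sum_snd_mul_dX_gLow hW hf hom hz]
  have : ∀ i, z.2 i * (1 / 2 * dX k (dY i fun w => f w ^ 2) z)
      = 1 / 2 * (z.2 i * dX k (dY i fun w => f w ^ 2) z) := fun i => by ring
  simp only [this, ← Finset.mul_sum]
  simp only [dX] at *
  simp at h
  linarith

end LocalCalculus

/-! ### The Cartan covariant derivative of the velocity and the Euler–Lagrange expression -/

section LocalGeodesic

variable {n : ℕ} {f : EuclideanSpace ℝ (Fin n) × EuclideanSpace ℝ (Fin n) → ℝ}
  {W : Set (EuclideanSpace ℝ (Fin n) × EuclideanSpace ℝ (Fin n))}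

theorem sum_snd_mul_cartanC (hW : IsOpen W) (hf : ContDiffOn ℝ ∞ f W)
    (hom : ∀ x y (r : ℝ), (x, y) ∈ W → f (x, r • y) = |r| * f (x, y))
    {z : EuclideanSpace ℝ (Fin n) × EuclideanSpace ℝ (Fin n)} (hz : z ∈ W) (i k : Fin n) :
    ∑ m, z.2 m * cartanC f i m k z = 0 := by
  -- By total symmetry two of the three terms cancel and the third contracts to zero with y.
  have ha : ∀ a, ∑ m, z.2 m *
      (dY m (gLow f a k) z + dY k (gLow f m a) z - dY a (gLow f m k) z) = 0 := by
    intro a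
    rw [← sum_snd_mul_dY_gLow hW hf hom hz a k]
    refine Finset.sum_congr rfl fun m _ => ?_
    rw [dY_gLow_symm hW hf hz a k m, dY_gLow_symm' hW hf hz m a k]
    ring
  calc ∑ m, z.2 m * cartanC f i m k z
      = 1 / 2 * ∑ a, gUp f i a z * ∑ m, z.2 m *
          (dY m (gLow f a k) z + dY k (gLow f m a) z - dY a (gLow f m k) z) := by
        simp only [cartanC, Finset.mul_sum]
        rw [Finset.sum_comm]
        exact Finset.sum_congr rfl fun a _ => Finset.sum_congr rfl fun m _ => by ring
    _ = 0 := by simp [ha]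

/-- The correction by N multiplies vertical derivatives of g, which vanish after contraction with y;
so δ/δx acts here like ∂/∂x. -/
theorem sum_snd_mul_deltaX_gLow (hW : IsOpen W) (hf : ContDiffOn ℝ ∞ f W)
    (hom : ∀ x y (r : ℝ), (x, y) ∈ W → f (x, r • y) = |r| * f (x, y))
    {z : EuclideanSpace ℝ (Fin n) × EuclideanSpace ℝ (Fin n)} (hz : z ∈ W) (m a : Fin n) :
    ∑ k, z.2 k * deltaX f m (gLow f a k) z = 1 / 2 * dX m (dY a (fun w => f w ^ 2)) z := by
  have h : ∑ k, z.2 k * ∑ b, nonlinConn f b m z * dY b (gLow f a k) z = 0 := by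
    calc _ = ∑ b, nonlinConn f b m z * ∑ k, z.2 k * dY b (gLow f a k) z := by
          simp only [Finset.mul_sum]
          rw [Finset.sum_comm]
          exact Finset.sum_congr rfl fun a _ => Finset.sum_congr rfl fun m _ => by ring
      _ = 0 := by simp [sum_snd_mul_dY_gLow hW hf hom hz]
  simp only [deltaX, mul_sub, Finset.sum_sub_distrib]
  rw [h, sum_snd_mul_dX_gLow hW hf hom hz, sub_zero]

theorem deltaX_gLow_symm (hW : IsOpen W) (hf : ContDiffOn ℝ ∞ f W)
    {z : EuclideanSpace ℝ (Fin n) × EuclideanSpace ℝ (Fin n)} (hz : z ∈ W) (i j k : Fin n) :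
    deltaX f k (gLow f i j) z = deltaX f k (gLow f j i) z := by
  simp only [deltaX, dX_gLow_symm hW hf hz i j, dY_gLow_symm' hW hf hz i j]

/-- Contracted twice with y, each δ-derivative of g in L becomes an x-derivative. The first two
terms of L then agree by the symmetry in m and k, and Euler's relations convert the rest into
derivatives of f². -/
theorem sum_sum_cartanL (hW : IsOpen W) (hf : ContDiffOn ℝ ∞ f W)
    (hom : ∀ x y (r : ℝ), (x, y) ∈ W → f (x, r • y) = |r| * f (x, y))
    {z : EuclideanSpace ℝ (Fin n) × EuclideanSpace ℝ (Fin n)} (hz : z ∈ W) (i : Fin n) :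
    ∑ m, z.2 m * ∑ k, cartanL f i m k z * z.2 k
      = 1 / 2 * ∑ a, gUp f i a z * (∑ j, z.2 j * dX j (dY a (fun w => f w ^ 2)) z
          - dX a (fun w => f w ^ 2) z) := by
  have ha : ∀ a, ∑ m, z.2 m * ∑ k, z.2 k *
      (deltaX f m (gLow f a k) z + deltaX f k (gLow f m a) z - deltaX f a (gLow f m k) z)
      = ∑ j, z.2 j * dX j (dY a (fun w => f w ^ 2)) z - dX a (fun w => f w ^ 2) z := by
    intro a
    have h1 : ∑ m, z.2 m * ∑ k, z.2 k * deltaX f m (gLow f a k) z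
        = 1 / 2 * ∑ j, z.2 j * dX j (dY a (fun w => f w ^ 2)) z := by
      simp only [sum_snd_mul_deltaX_gLow hW hf hom hz, Finset.mul_sum]
      exact Finset.sum_congr rfl fun m _ => by ring
    have h2 : ∑ m, z.2 m * ∑ k, z.2 k * deltaX f k (gLow f m a) z
        = 1 / 2 * ∑ j, z.2 j * dX j (dY a (fun w => f w ^ 2)) z := by
      rw [← h1]
      simp only [Finset.mul_sum]
      rw [Finset.sum_comm]
      exact Finset.sum_congr rfl fun m _ => Finset.sum_congr rfl fun k _ => by
        rw [deltaX_gLow_symm hW hf hz k a]; ring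
    have h3 : ∑ m, z.2 m * ∑ k, z.2 k * deltaX f a (gLow f m k) z
        = dX a (fun w => f w ^ 2) z := by
      rw [← sum_sum_dX_gLow hW hf hom hz]
      simp only [sum_snd_mul_deltaX_gLow hW hf hom hz, sum_snd_mul_dX_gLow hW hf hom hz]
    simp only [mul_sub, mul_add, Finset.sum_sub_distrib, Finset.sum_add_distrib]
    rw [h1, h2, h3]
    ring
  simp only [← ha, cartanL, Finset.mul_sum, Finset.sum_mul]
  rw [Finset.sum_comm' (t' := Finset.univ) (s' := fun _ => Finset.univ) (by simp)]
  rw [Finset.sum_comm]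
  conv_rhs => rw [Finset.sum_comm]
  refine Finset.sum_congr rfl fun m _ => ?_
  rw [Finset.sum_comm]
  exact Finset.sum_congr rfl fun a _ => Finset.sum_congr rfl fun k _ => by ring

theorem sum_gLow_mul_gUp {z : EuclideanSpace ℝ (Fin n) × EuclideanSpace ℝ (Fin n)}
    (hdet : IsUnit (Matrix.of fun a b : Fin n => gLow f a b z).det) (R : Fin n → ℝ) (l : Fin n) :
    ∑ i, gLow f l i z * ∑ a, gUp f i a z * R a = R l := by
  have h := congrFun (congrArg (fun A => A.mulVec R)
    (Matrix.mul_nonsing_inv (Matrix.of fun a b : Fin n => gLow f a b z) hdet)) l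
  simp only [← Matrix.mulVec_mulVec, Matrix.one_mulVec] at h
  exact h

/-- Lowering the index of `∇ẋ/dt` gives the Euler–Lagrange expression of `½ f²`. -/
theorem sum_gLow_mul_covDerivLocal (hW : IsOpen W) (hf : ContDiffOn ℝ ∞ f W)
    (hom : ∀ x y (r : ℝ), (x, y) ∈ W → f (x, r • y) = |r| * f (x, y))
    {x : ℝ → EuclideanSpace ℝ (Fin n)} {t : ℝ} (hz : (x t, deriv x t) ∈ W)
    (hdet : IsUnit (Matrix.of fun a b : Fin n => gLow f a b (x t, deriv x t)).det) (l : Fin n) :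
    ∑ i, gLow f l i (x t, deriv x t) * covDerivLocal f x (deriv x) t i
      = 1 / 2 * (fderiv ℝ (dY l (fun w => f w ^ 2)) (x t, deriv x t)
            (deriv x t, deriv (deriv x) t)
          - dX l (fun w => f w ^ 2) (x t, deriv x t)) := by
  have hi : ∀ i, covDerivLocal f x (deriv x) t i = deriv (deriv x) t i
      + 1 / 2 * ∑ a, gUp f i a (x t, deriv x t) *
        (∑ j, deriv x t j * dX j (dY a (fun w => f w ^ 2)) (x t, deriv x t)
          - dX a (fun w => f w ^ 2) (x t, deriv x t)) := by
    intro i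
    have hL := sum_sum_cartanL hW hf hom hz i
    -- The contraction vanishes against every w, in particular against δẋ/dt, so neither ẍ nor N
    -- contributes through C.
    have hC : ∀ w : Fin n → ℝ, ∑ m, deriv x t m * ∑ k, cartanC f i m k (x t, deriv x t) * w k
        = 0 := by
      intro w
      calc _ = ∑ k, w k * ∑ m, deriv x t m * cartanC f i m k (x t, deriv x t) := by
            simp only [Finset.mul_sum]
            rw [Finset.sum_comm]
            exact Finset.sum_congr rfl fun a _ => Finset.sum_congr rfl fun m _ => by ring
        _ = 0 := by simp [sum_snd_mul_cartanC hW hf hom hz]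
    simp only [covDerivLocal, Finset.sum_add_distrib, mul_add]
    simp only [← mul_add, ← Finset.sum_add_distrib]
    simp only [Finset.sum_add_distrib, mul_add _ (∑ k, _ * _)]
    rw [hC fun k => deriv (deriv x) t k
      + ∑ l, nonlinConn f k l (x t, deriv x t) * deriv x t l]
    simp only [hL, add_zero]
  simp only [hi, mul_add, Finset.sum_add_distrib]
  have h2 : ∑ i, gLow f l i (x t, deriv x t) * (1 / 2 * ∑ a, gUp f i a (x t, deriv x t) *
        (∑ j, deriv x t j * dX j (dY a (fun w => f w ^ 2)) (x t, deriv x t)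
          - dX a (fun w => f w ^ 2) (x t, deriv x t)))
      = 1 / 2 * (∑ j, deriv x t j * dX j (dY l (fun w => f w ^ 2)) (x t, deriv x t)
          - dX l (fun w => f w ^ 2) (x t, deriv x t)) := by
    rw [← sum_gLow_mul_gUp hdet (fun a =>
      ∑ j, deriv x t j * dX j (dY a (fun w => f w ^ 2)) (x t, deriv x t)
          - dX a (fun w => f w ^ 2) (x t, deriv x t)) l, Finset.mul_sum]
    exact Finset.sum_congr rfl fun a _ => by ring
  rw [h2, fderiv_eq_sum]
  have h3 : ∑ i, gLow f l i (x t, deriv x t) * deriv (deriv x) t i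
      = 1 / 2 * ∑ i, deriv (deriv x) t i * dY i (dY l (fun w => f w ^ 2)) (x t, deriv x t) := by
    rw [Finset.mul_sum]
    refine Finset.sum_congr rfl fun i _ => ?_
    rw [gLow_symm hW hf hz, gLow]
    ring
  rw [h3]
  ring

end LocalGeodesic

/-! ### The fundamental tensor as a bilinear form and the local first variation -/

section LocalFundamentalTensor

variable {n : ℕ} {f : EuclideanSpace ℝ (Fin n) × EuclideanSpace ℝ (Fin n) → ℝ}
  {W : Set (EuclideanSpace ℝ (Fin n) × EuclideanSpace ℝ (Fin n))}

/-- The bilinear form `g_{ij} Uⁱ Vʲ`. -/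
noncomputable def gForm (f : EuclideanSpace ℝ (Fin n) × EuclideanSpace ℝ (Fin n) → ℝ)
    (z : EuclideanSpace ℝ (Fin n) × EuclideanSpace ℝ (Fin n)) (U V : EuclideanSpace ℝ (Fin n)) :
    ℝ :=
  ∑ i, U i * ∑ j, gLow f i j z * V j

theorem gForm_add_right (z : EuclideanSpace ℝ (Fin n) × EuclideanSpace ℝ (Fin n))
    (U V V' : EuclideanSpace ℝ (Fin n)) :
    gForm f z U (V + V') = gForm f z U V + gForm f z U V' := by
  simp [gForm, mul_add, Finset.sum_add_distrib]

theorem gForm_smul_right (z : EuclideanSpace ℝ (Fin n) × EuclideanSpace ℝ (Fin n))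
    (U V : EuclideanSpace ℝ (Fin n)) (r : ℝ) :
    gForm f z U (r • V) = r * gForm f z U V := by
  simp only [gForm, PiLp.smul_apply, smul_eq_mul, Finset.mul_sum]
  exact Finset.sum_congr rfl fun i _ => Finset.sum_congr rfl fun j _ => by ring

theorem gForm_symm (hW : IsOpen W) (hf : ContDiffOn ℝ ∞ f W)
    {z : EuclideanSpace ℝ (Fin n) × EuclideanSpace ℝ (Fin n)} (hz : z ∈ W)
    (U V : EuclideanSpace ℝ (Fin n)) : gForm f z U V = gForm f z V U := by
  simp only [gForm, Finset.mul_sum]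
  rw [Finset.sum_comm]
  exact Finset.sum_congr rfl fun i _ => Finset.sum_congr rfl fun j _ => by
    rw [gLow_symm hW hf hz]; ring

theorem gForm_snd_right (hW : IsOpen W) (hf : ContDiffOn ℝ ∞ f W)
    (hom : ∀ x y (r : ℝ), (x, y) ∈ W → f (x, r • y) = |r| * f (x, y))
    {z : EuclideanSpace ℝ (Fin n) × EuclideanSpace ℝ (Fin n)} (hz : z ∈ W)
    (U : EuclideanSpace ℝ (Fin n)) :
    gForm f z U z.2 = 1 / 2 * ∑ l, U l * dY l (fun w => f w ^ 2) z := by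
  simp only [gForm, mul_comm (gLow _ _ _ _) (z.2 _), sum_snd_mul_gLow hW hf hom hz,
    Finset.mul_sum]
  exact Finset.sum_congr rfl fun i _ => by ring

theorem gForm_snd_snd (hW : IsOpen W) (hf : ContDiffOn ℝ ∞ f W)
    (hom : ∀ x y (r : ℝ), (x, y) ∈ W → f (x, r • y) = |r| * f (x, y))
    {z : EuclideanSpace ℝ (Fin n) × EuclideanSpace ℝ (Fin n)} (hz : z ∈ W) :
    gForm f z z.2 z.2 = f z ^ 2 := by
  rw [gForm_snd_right hW hf hom hz, sum_snd_mul_dY_sq hW hf hom hz]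
  ring

/-- The bridge between the chart-free second derivative used on the manifold and the components
g_ij. -/
theorem half_deriv_deriv_sq_eq_gForm (hW : IsOpen W) (hf : ContDiffOn ℝ ∞ f W)
    {x Y : EuclideanSpace ℝ (Fin n)} (hz : (x, Y) ∈ W) (U V : EuclideanSpace ℝ (Fin n)) :
    1 / 2 * deriv (fun a : ℝ => deriv (fun b : ℝ => f (x, Y + a • U + b • V) ^ 2) 0) 0
      = gForm f (x, Y) U V := by
  have hl : ∀ (P Q : EuclideanSpace ℝ (Fin n)),
      HasDerivAt (fun a : ℝ => (x, P + a • Q)) ((0 : EuclideanSpace ℝ (Fin n)), Q) 0 := by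
    intro P Q
    have := ((hasDerivAt_id (0 : ℝ)).smul_const Q).const_add P
    rw [one_smul] at this
    exact (hasDerivAt_const _ _).prodMk this
  have hin : ∀ᶠ a in nhds (0 : ℝ), (x, Y + a • U) ∈ W :=
    (hl Y U).continuousAt.preimage_mem_nhds (hW.mem_nhds (by simpa using hz))
  have h1 : (fun a : ℝ => deriv (fun b : ℝ => f (x, Y + a • U + b • V) ^ 2) 0)
      =ᶠ[nhds 0] fun a => ∑ j, V j * dY j (fun w => f w ^ 2) (x, Y + a • U) := by
    filter_upwards [hin] with a ha
    have hd := (contDiffOn_differentiableAt hW (hf.pow 2) ha).hasFDerivAt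
    have hd' : HasFDerivAt (fun w => f w ^ 2) (fderiv ℝ (fun w => f w ^ 2) (x, Y + a • U))
        (x, Y + a • U + (0 : ℝ) • V) := by simpa using hd
    have := (hd'.comp_hasDerivAt (0 : ℝ) (hl (Y + a • U) V)).deriv
    refine Eq.trans this ?_
    rw [fderiv_eq_sum]
    simp
  rw [h1.deriv_eq]
  have h2 : HasDerivAt (fun a : ℝ => ∑ j, V j * dY j (fun w => f w ^ 2) (x, Y + a • U))
      (∑ j, V j * fderiv ℝ (dY j (fun w => f w ^ 2)) (x, Y) (0, U)) 0 := by
    refine HasDerivAt.fun_sum fun j _ => HasDerivAt.const_mul _ ?_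
    have hd := (contDiffOn_differentiableAt hW (contDiffOn_dY hW (hf.pow 2) j) hz).hasFDerivAt
    have hd' : HasFDerivAt (dY j (fun w => f w ^ 2))
        (fderiv ℝ (dY j (fun w => f w ^ 2)) (x, Y)) (x, Y + (0 : ℝ) • U) := by simpa using hd
    exact hd'.comp_hasDerivAt (0 : ℝ) (hl Y U)
  rw [h2.deriv, gForm_symm hW hf hz]
  simp only [gForm, fderiv_eq_sum, Finset.mul_sum, gLow]
  refine Finset.sum_congr rfl fun j _ => ?_
  simp only [PiLp.zero_apply, zero_mul, Finset.sum_const_zero, zero_add, Finset.mul_sum]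
  refine Finset.sum_congr rfl fun i _ => ?_
  rw [dY_comm hW (hf.pow 2) hz]
  ring

theorem fderiv_sq (hW : IsOpen W) (hf : ContDiffOn ℝ ∞ f W)
    {z : EuclideanSpace ℝ (Fin n) × EuclideanSpace ℝ (Fin n)} (hz : z ∈ W)
    (v : EuclideanSpace ℝ (Fin n) × EuclideanSpace ℝ (Fin n)) :
    fderiv ℝ (fun w => f w ^ 2) z v = 2 * f z * fderiv ℝ f z v := by
  have := ((contDiffOn_differentiableAt hW hf hz).hasFDerivAt.pow 2).fderiv
  refine (congrArg (fun T => T v) this).trans ?_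
  simp

/-- Up to the factor p, the momentum is the fibre derivative of f^p. This form makes no reference to
second derivatives of f. -/
theorem hasDerivAt_rpow_add_smul (hW : IsOpen W) (hf : ContDiffOn ℝ ∞ f W)
    (hom : ∀ x y (r : ℝ), (x, y) ∈ W → f (x, r • y) = |r| * f (x, y))
      {x Y : EuclideanSpace ℝ (Fin n)}
    (hz : (x, Y) ∈ W) (hpos : 0 < f (x, Y)) (U : EuclideanSpace ℝ (Fin n)) (p : ℝ) :
    HasDerivAt (fun r : ℝ => f (x, Y + r • U) ^ p)
      (p * (f (x, Y) ^ (p - 2) * gForm f (x, Y) U Y)) 0 := by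
  have hl : HasDerivAt (fun a : ℝ => (x, Y + a • U)) ((0 : EuclideanSpace ℝ (Fin n)), U) 0 := by
    have := ((hasDerivAt_id (0 : ℝ)).smul_const U).const_add Y
    rw [one_smul] at this
    exact (hasDerivAt_const _ _).prodMk this
  have hd : HasFDerivAt f (fderiv ℝ f (x, Y)) (x, Y + (0 : ℝ) • U) := by
    simpa using (contDiffOn_differentiableAt hW hf hz).hasFDerivAt
  have h := (hd.comp_hasDerivAt (0 : ℝ) hl).rpow_const (p := p) (Or.inl (by simpa using hpos.ne'))
  refine h.congr_deriv ?_
  have hg := gForm_snd_right hW hf hom hz U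
  have hs : fderiv ℝ (fun w => f w ^ 2) (x, Y) (0, U)
      = ∑ l, U l * dY l (fun w => f w ^ 2) (x, Y) := by
    rw [fderiv_eq_sum]; simp
  rw [← hs, fderiv_sq hW hf hz] at hg
  simp only [Function.comp_apply, zero_smul, add_zero] at hg ⊢
  rw [hg, show p - 1 = p - 2 + 1 by ring, Real.rpow_add_one hpos.ne']
  ring

/-- The first variation formula for `f ^ p`, pointwise and in coordinates. -/
theorem hasDerivAt_momentum_local (hW : IsOpen W) (hf : ContDiffOn ℝ ∞ f W)
    (hom : ∀ x y (r : ℝ), (x, y) ∈ W → f (x, r • y) = |r| * f (x, y))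
    {u : ℝ × ℝ → EuclideanSpace ℝ (Fin n)} {t : ℝ} (hu : ContDiffAt ℝ ∞ u (0, t))
    (hz : (u (0, t), fderiv ℝ u (0, t) (0, 1)) ∈ W)
    (hpos : 0 < f (u (0, t), fderiv ℝ u (0, t) (0, 1)))
    (hdet : IsUnit (Matrix.of fun a b : Fin n =>
      gLow f a b (u (0, t), fderiv ℝ u (0, t) (0, 1))).det) (p : ℝ) :
    HasDerivAt (fun τ => p * (f (u (0, τ), fderiv ℝ u (0, τ) (0, 1)) ^ (p - 2) *
        gForm f (u (0, τ), fderiv ℝ u (0, τ) (0, 1)) (fderiv ℝ u (0, τ) (1, 0))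
          (fderiv ℝ u (0, τ) (0, 1))))
      (deriv (fun s => f (u (s, t), fderiv ℝ u (s, t) (0, 1)) ^ p) 0
        + p * (f (u (0, t), fderiv ℝ u (0, t) (0, 1)) ^ (p - 4) *
          gForm f (u (0, t), fderiv ℝ u (0, t) (0, 1)) (fderiv ℝ u (0, t) (1, 0))
            (f (u (0, t), fderiv ℝ u (0, t) (0, 1)) ^ 2 •
                covDerivLocal f (fun τ => u (0, τ)) (deriv fun τ => u (0, τ)) t
              + ((p - 2) * gForm f (u (0, t), fderiv ℝ u (0, t) (0, 1))
                  (covDerivLocal f (fun τ => u (0, τ)) (deriv fun τ => u (0, τ)) t)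
                  (fderiv ℝ u (0, t) (0, 1))) • fderiv ℝ u (0, t) (0, 1)))) t := by
  have hline : ∀ τ : ℝ, HasDerivAt (fun τ : ℝ => ((0 : ℝ), τ)) ((0 : ℝ), (1 : ℝ)) τ := fun τ =>
    (hasDerivAt_const _ _).prodMk (hasDerivAt_id τ)
  have hline' : HasDerivAt (fun s : ℝ => (s, t)) ((1 : ℝ), (0 : ℝ)) 0 :=
    (hasDerivAt_id (0 : ℝ)).prodMk (hasDerivAt_const _ _)
  have hu1 : ∀ᶠ q in nhds ((0 : ℝ), t), DifferentiableAt ℝ u q := by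
    have := (hu.of_le (m := 1) (by norm_cast)).eventually (by simp)
    filter_upwards [this] with q hq using hq.differentiableAt (by simp)
  have hx : ∀ᶠ τ in nhds t, HasDerivAt (fun τ => u (0, τ)) (fderiv ℝ u (0, τ) (0, 1)) τ := by
    filter_upwards [(hline t).continuousAt.eventually hu1] with τ hτ
    exact hτ.hasFDerivAt.comp_hasDerivAt τ (hline τ)
  have hdx : (deriv fun τ => u (0, τ)) =ᶠ[nhds t] fun τ => fderiv ℝ u (0, τ) (0, 1) := by
    filter_upwards [hx] with τ hτ using hτ.deriv
  have hfd : DifferentiableAt ℝ (fderiv ℝ u) (0, t) :=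
    (hu.fderiv_right (m := 1) (by norm_cast)).differentiableAt (by simp)
  have hfv : ∀ v, HasFDerivAt (fun q => fderiv ℝ u q v)
      (fderiv ℝ (fun q => fderiv ℝ u q v) (0, t)) (0, t) := fun v =>
    (hfd.clm_apply (differentiableAt_const v)).hasFDerivAt
  set y := fderiv ℝ u (0, t) (0, 1) with hy
  set X := fderiv ℝ u (0, t) (1, 0) with hX
  set X' := fderiv ℝ (fun q => fderiv ℝ u q (1, 0)) (0, t) (0, 1) with hX'
  -- Equality of mixed partials: the s-derivative of the velocity is the t-derivative of the
  -- variation field.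
  have hcomm : fderiv ℝ (fun q => fderiv ℝ u q (0, 1)) (0, t) (1, 0) = X' :=
    fderiv_fderiv_apply_comm hu _ _
  set w := deriv (deriv fun τ => u (0, τ)) t with hw
  have hyt : deriv (fun τ => u (0, τ)) t = y := hdx.eq_of_nhds
  have hdy : HasDerivAt (fun τ => fderiv ℝ u (0, τ) (0, 1)) w t := by
    have h := (hfv (0, 1)).comp_hasDerivAt t (hline t)
    rw [hw, hdx.deriv_eq]
    exact h.differentiableAt.hasDerivAt
  have hdX : HasDerivAt (fun τ => fderiv ℝ u (0, τ) (1, 0)) X' t :=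
    (hfv (1, 0)).comp_hasDerivAt t (hline t)
  have hzt : HasDerivAt (fun τ => (u (0, τ), fderiv ℝ u (0, τ) (0, 1))) (y, w) t :=
    hx.self_of_nhds.prodMk hdy
  have hzs : HasDerivAt (fun s => (u (s, t), fderiv ℝ u (s, t) (0, 1))) (X, X') 0 := by
    refine HasDerivAt.prodMk ?_ ?_
    · exact hu1.self_of_nhds.hasFDerivAt.comp_hasDerivAt (0 : ℝ) hline'
    · rw [← hcomm]
      exact (hfv (0, 1)).comp_hasDerivAt (0 : ℝ) hline'
  set z := (u (0, t), y) with hzdef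
  have hfz := (contDiffOn_differentiableAt hW hf hz).hasFDerivAt
  set φ := f z with hφ
  have hD : deriv (fun s => f (u (s, t), fderiv ℝ u (s, t) (0, 1)) ^ p) 0
      = fderiv ℝ f z (X, X') * p * φ ^ (p - 1) :=
    ((HasFDerivAt.comp_hasDerivAt (0 : ℝ) hfz hzs).rpow_const (Or.inl hpos.ne')).deriv
  have hmem : ∀ᶠ τ in nhds t, (u (0, τ), fderiv ℝ u (0, τ) (0, 1)) ∈ W :=
    hzt.continuousAt.preimage_mem_nhds (hW.mem_nhds hz)
  have hA : HasDerivAt (fun τ => ∑ l, fderiv ℝ u (0, τ) (1, 0) l *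
        dY l (fun w => f w ^ 2) (u (0, τ), fderiv ℝ u (0, τ) (0, 1)))
      (∑ l, (X' l * dY l (fun w => f w ^ 2) z
        + X l * fderiv ℝ (dY l (fun w => f w ^ 2)) z (y, w))) t := by
    refine HasDerivAt.fun_sum fun l _ => HasDerivAt.mul ?_ ?_
    · exact (EuclideanSpace.proj l : EuclideanSpace ℝ (Fin n) →L[ℝ] ℝ).hasFDerivAt.comp_hasDerivAt
        t hdX
    · exact HasFDerivAt.comp_hasDerivAt t (contDiffOn_differentiableAt hW
        (contDiffOn_dY hW (hf.pow 2) l) hz).hasFDerivAt hzt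
  have hP := (((HasFDerivAt.comp_hasDerivAt t hfz hzt).rpow_const (p := p - 2)
    (Or.inl hpos.ne')).mul (hA.const_mul (1 / 2))).const_mul p
  refine (hP.congr_of_eventuallyEq ?_).congr_deriv ?_
  · filter_upwards [hmem] with τ hτ
    have := gForm_snd_right hW hf hom hτ (fderiv ℝ u (0, τ) (1, 0))
    simp only [Pi.mul_apply, Function.comp_apply]
    rw [← this]
  have hlow : ∀ l, ∑ i, gLow f l i z * covDerivLocal f (fun τ => u (0, τ))
        (deriv fun τ => u (0, τ)) t i
      = 1 / 2 * (fderiv ℝ (dY l (fun w => f w ^ 2)) z (y, w) - dX l (fun w => f w ^ 2) z) := by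
    intro l
    have := sum_gLow_mul_covDerivLocal (x := fun τ => u (0, τ)) (t := t) hW hf hom
      (by rw [hyt]; exact hz) (by rw [hyt]; exact hdet) l
    rwa [hyt] at this
  have hXc : ∀ V : EuclideanSpace ℝ (Fin n), gForm f z V (covDerivLocal f (fun τ => u (0, τ))
        (deriv fun τ => u (0, τ)) t)
      = 1 / 2 * (∑ l, V l * fderiv ℝ (dY l (fun w => f w ^ 2)) z (y, w)
        - ∑ l, V l * dX l (fun w => f w ^ 2) z) := by
    intro V
    simp only [gForm, hlow, ← Finset.sum_sub_distrib, Finset.mul_sum]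
    exact Finset.sum_congr rfl fun l _ => by ring
  -- The differentiated Euler relation turns the Euler–Lagrange expression paired with y into half
  -- the derivative of f² along the curve.
  have hyc : gForm f z (covDerivLocal f (fun τ => u (0, τ)) (deriv fun τ => u (0, τ)) t) y
      = φ * fderiv ℝ f z (y, w) := by
    rw [gForm_symm hW hf hz, hXc]
    have e1 := sum_snd_mul_fderiv_dY_sq hW hf hom hz (y, w)
    have e2 := fderiv_eq_sum (fun w => f w ^ 2) z y w
    rw [fderiv_sq hW hf hz] at e1 e2
    simp only [hzdef] at e1 e2 ⊢
    linarith
  have hXy : gForm f z X y = 1 / 2 * ∑ l, X l * dY l (fun w => f w ^ 2) z :=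
    gForm_snd_right hW hf hom hz X
  have hDX := fderiv_eq_sum (fun w => f w ^ 2) z X X'
  rw [fderiv_sq hW hf hz] at hDX
  rw [hD, gForm_add_right, gForm_smul_right, gForm_smul_right, hyc, hXy, hXc]
  -- All powers are reduced to φ^(p - 4) times a natural power, which is legitimate for real p
  -- because φ > 0.
  have r1 : φ ^ (p - 1) = φ ^ (p - 4) * φ ^ 3 := by
    rw [← Real.rpow_natCast, ← Real.rpow_add hpos]; congr 1; push_cast; ring
  have r2 : φ ^ (p - 2) = φ ^ (p - 4) * φ ^ 2 := by
    rw [← Real.rpow_natCast, ← Real.rpow_add hpos]; congr 1; push_cast; ring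
  have r3 : φ ^ (p - 2 - 1) = φ ^ (p - 4) * φ := by
    rw [← Real.rpow_add_one hpos.ne']; congr 1; ring
  simp only [Function.comp_apply, ← hy, ← hzdef, ← hφ, ← hX, r1, r2, r3, Finset.sum_add_distrib]
  linear_combination (-(p * φ ^ (p - 4) * φ ^ 2 / 2)) * hDX

end LocalFundamentalTensor

/-! ### Passage between the manifold and the preferred charts -/

section Coordinates

variable {n : ℕ} {M : Type*} [TopologicalSpace M] [ChartedSpace (EuclideanSpace ℝ (Fin n)) M]

/-- The coordinate domain of the slit tangent bundle over the preferred chart at `x₀`. -/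
def slitTarget (n : ℕ) {M : Type*} [TopologicalSpace M]
    [ChartedSpace (EuclideanSpace ℝ (Fin n)) M] (x₀ : M) :
    Set (EuclideanSpace ℝ (Fin n) × EuclideanSpace ℝ (Fin n)) :=
  (extChartAt (𝓡 n) x₀).target ×ˢ {0}ᶜ

theorem isOpen_slitTarget (x₀ : M) : IsOpen (slitTarget n x₀) :=
  (isOpen_extChartAt_target x₀).prod isOpen_compl_singleton

variable [IsManifold (𝓡 n) ∞ M]

theorem isManifold_one_of_infty (n : ℕ) (M : Type*) [TopologicalSpace M]
    [ChartedSpace (EuclideanSpace ℝ (Fin n)) M] [IsManifold (𝓡 n) ∞ M] :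
    IsManifold (𝓡 n) 1 M := IsManifold.of_le (n := ∞) (by norm_cast)

/-- The components of tangent vectors at `b` in the preferred chart at `x₀`. -/
noncomputable def chartCoord (x₀ b : M) : TangentSpace (𝓡 n) b →L[ℝ] EuclideanSpace ℝ (Fin n) :=
  (trivializationAt (EuclideanSpace ℝ (Fin n)) (TangentSpace (𝓡 n)) x₀).continuousLinearMapAt ℝ b

theorem chartCoord_eq {x₀ b : M} (hb : b ∈ (chartAt (EuclideanSpace ℝ (Fin n)) x₀).source)
    (v : TangentSpace (𝓡 n) b) :
    chartCoord x₀ b v = (trivializationAt (EuclideanSpace ℝ (Fin n)) (TangentSpace (𝓡 n)) x₀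
      (⟨b, v⟩ : TangentBundle (𝓡 n) M)).2 :=
  (trivializationAt (EuclideanSpace ℝ (Fin n)) (TangentSpace (𝓡 n))
    x₀).continuousLinearMapAt_apply_of_mem ℝ hb v

theorem symm_chartCoord {x₀ b : M} (hb : b ∈ (chartAt (EuclideanSpace ℝ (Fin n)) x₀).source)
    (v : TangentSpace (𝓡 n) b) :
    (trivializationAt (EuclideanSpace ℝ (Fin n)) (TangentSpace (𝓡 n)) x₀).symm b (chartCoord x₀ b v)
      = v := by
  have h := (trivializationAt (EuclideanSpace ℝ (Fin n)) (TangentSpace (𝓡 n))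
    x₀).symmL_continuousLinearMapAt (R := ℝ) (b := b) hb v
  rwa [Bundle.Trivialization.symmL_apply (R := ℝ) (trivializationAt (EuclideanSpace ℝ (Fin n))
    (TangentSpace (𝓡 n)) x₀) hb] at h

theorem chartCoord_symm {x₀ b : M} (hb : b ∈ (chartAt (EuclideanSpace ℝ (Fin n)) x₀).source)
    (V : EuclideanSpace ℝ (Fin n)) :
    chartCoord x₀ b ((trivializationAt (EuclideanSpace ℝ (Fin n)) (TangentSpace (𝓡 n)) x₀).symm b V)
      = V := by
  have h := (trivializationAt (EuclideanSpace ℝ (Fin n)) (TangentSpace (𝓡 n))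
    x₀).continuousLinearMapAt_symmL (R := ℝ) (b := b) hb V
  rwa [Bundle.Trivialization.symmL_apply (R := ℝ) (trivializationAt (EuclideanSpace ℝ (Fin n))
    (TangentSpace (𝓡 n)) x₀) hb] at h

theorem chartCoord_ne_zero {x₀ b : M} (hb : b ∈ (chartAt (EuclideanSpace ℝ (Fin n)) x₀).source)
    {v : TangentSpace (𝓡 n) b} (hv : v ≠ 0) : chartCoord x₀ b v ≠ 0 := by
  intro h
  have h0 := symm_chartCoord hb (0 : TangentSpace (𝓡 n) b)
  rw [map_zero, ← h, symm_chartCoord hb] at h0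
  exact hv h0

/-- The tangent bundle trivialization is fibrewise the derivative of the chart, so this is the chain
rule. -/
theorem chartCoord_mfderiv {E' : Type*} [NormedAddCommGroup E'] [NormedSpace ℝ E'] {G : E' → M}
    {q : E'}
    {x₀ : M} (hq : G q ∈ (chartAt (EuclideanSpace ℝ (Fin n)) x₀).source)
    (hG : MDifferentiableAt 𝓘(ℝ, E') (𝓡 n) G q) (v : E') :
    chartCoord x₀ (G q) (mfderiv 𝓘(ℝ, E') (𝓡 n) G q v)
      = fderiv ℝ (fun q => extChartAt (𝓡 n) x₀ (G q)) q v := by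
  have := isManifold_one_of_infty n M
  rw [chartCoord, TangentBundle.continuousLinearMapAt_trivializationAt hq, ← mfderiv_eq_fderiv]
  have h := mfderiv_comp q (mdifferentiableAt_extChartAt (I := 𝓡 n) hq) hG
  exact (congrArg (fun T => T v) h).symm

namespace FinslerMetric

variable (𝓕 : FinslerMetric n M)

theorem localF_chartCoord {x₀ b : M} (hb : b ∈ (chartAt (EuclideanSpace ℝ (Fin n)) x₀).source)
    (v : TangentSpace (𝓡 n) b) :
    𝓕.localF x₀ (extChartAt (𝓡 n) x₀ b, chartCoord x₀ b v) = 𝓕.F ⟨b, v⟩ := by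
  have h : (extChartAt (𝓡 n) x₀).symm (extChartAt (𝓡 n) x₀ b) = b :=
    (extChartAt (𝓡 n) x₀).left_inv (by simpa using hb)
  rw [localF]
  simp only
  rw [h, symm_chartCoord hb]

theorem mem_slitTarget {x₀ b : M} (hb : b ∈ (chartAt (EuclideanSpace ℝ (Fin n)) x₀).source)
    {v : TangentSpace (𝓡 n) b} (hv : v ≠ 0) :
    (extChartAt (𝓡 n) x₀ b, chartCoord x₀ b v) ∈ slitTarget n x₀ :=
  ⟨(extChartAt (𝓡 n) x₀).map_source (by simpa using hb), chartCoord_ne_zero hb hv⟩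

theorem exists_of_mem_slitTarget {x₀ : M}
    {z : EuclideanSpace ℝ (Fin n) × EuclideanSpace ℝ (Fin n)} (hz : z ∈ slitTarget n x₀) :
    ∃ b ∈ (chartAt (EuclideanSpace ℝ (Fin n)) x₀).source, ∃ v : TangentSpace (𝓡 n) b, v ≠ 0 ∧
      z = (extChartAt (𝓡 n) x₀ b, chartCoord x₀ b v) := by
  have hb : (extChartAt (𝓡 n) x₀).symm z.1 ∈ (chartAt (EuclideanSpace ℝ (Fin n)) x₀).source := by
    simpa using (extChartAt (𝓡 n) x₀).map_target hz.1
  refine ⟨_, hb, (trivializationAt (EuclideanSpace ℝ (Fin n)) (TangentSpace (𝓡 n)) x₀).symm _ z.2,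
    ?_, ?_⟩
  · intro h
    have := chartCoord_symm hb z.2
    rw [h, map_zero] at this
    exact hz.2 this.symm
  · rw [chartCoord_symm hb, (extChartAt (𝓡 n) x₀).right_inv hz.1]

theorem localF_smul (x₀ : M) (x y : EuclideanSpace ℝ (Fin n)) (r : ℝ)
    (hz : (x, y) ∈ slitTarget n x₀) :
    𝓕.localF x₀ (x, r • y) = |r| * 𝓕.localF x₀ (x, y) := by
  obtain ⟨b, hb, v, hv, h⟩ := exists_of_mem_slitTarget hz
  obtain ⟨rfl, rfl⟩ := Prod.mk.inj h
  rw [← map_smul, 𝓕.localF_chartCoord hb, 𝓕.localF_chartCoord hb, 𝓕.homogeneous]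

/-- Positivity, together with homogeneity at r = 0, identifies the slit bundle with the set where
the continuous function F is nonzero. Openness upgrades smoothness on the slit bundle to smoothness
at each of its points. -/
theorem isOpen_slit (𝓕 : FinslerMetric n M) : IsOpen {v : TangentBundle (𝓡 n) M | v.2 ≠ 0} := by
  have h : {v : TangentBundle (𝓡 n) M | v.2 ≠ 0} = 𝓕.F ⁻¹' {0}ᶜ := by
    ext ⟨b, v⟩
    constructor
    · intro hv
      exact (𝓕.pos b v hv).ne'
    · intro hv h0
      apply hv
      have h0' : v = 0 := h0
      have := 𝓕.homogeneous b 0 v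
      rw [zero_smul, abs_zero, zero_mul] at this
      rw [h0']
      exact this
  rw [h]
  exact isOpen_compl_singleton.preimage 𝓕.continuous

theorem contMDiffAt_F {v : TangentBundle (𝓡 n) M} (hv : v.2 ≠ 0) :
    ContMDiffAt (𝓡 n).tangent 𝓘(ℝ, ℝ) ∞ 𝓕.F v :=
  𝓕.smooth.contMDiffAt (𝓕.isOpen_slit.mem_nhds hv)

theorem contDiffOn_localF (x₀ : M) : ContDiffOn ℝ ∞ (𝓕.localF x₀) (slitTarget n x₀) := by
  have := isManifold_one_of_infty n M
  have : IsManifold (𝓡 n) (∞ + 1) M := inferInstanceAs (IsManifold (𝓡 n) ∞ M)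
  intro z hz
  refine ContDiffAt.contDiffWithinAt ?_
  rw [← contMDiffAt_iff_contDiffAt]
  obtain ⟨b, hb, v, hv, rfl⟩ := exists_of_mem_slitTarget hz
  have hbb : (extChartAt (𝓡 n) x₀).symm (extChartAt (𝓡 n) x₀ b) = b :=
    (extChartAt (𝓡 n) x₀).left_inv (by simpa using hb)
  refine ContMDiffAt.comp (I' := (𝓡 n).tangent) _ (𝓕.contMDiffAt_F ?_) ?_
  · simp only
    rw [hbb, symm_chartCoord hb]
    exact hv
  · rw [Bundle.Trivialization.contMDiffAt_iff
      (e := trivializationAt (EuclideanSpace ℝ (Fin n)) (TangentSpace (𝓡 n)) x₀)]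
    · have h1 : ContMDiffAt 𝓘(ℝ, EuclideanSpace ℝ (Fin n) × EuclideanSpace ℝ (Fin n)) (𝓡 n) ∞
          (fun z : EuclideanSpace ℝ (Fin n) × EuclideanSpace ℝ (Fin n) =>
            (extChartAt (𝓡 n) x₀).symm z.1) (extChartAt (𝓡 n) x₀ b, chartCoord x₀ b v) :=
        ((contMDiffOn_extChartAt_symm x₀).contMDiffAt
          ((isOpen_extChartAt_target x₀).mem_nhds hz.1)).comp
          (extChartAt (𝓡 n) x₀ b, chartCoord x₀ b v) contDiffAt_fst.contMDiffAt
      refine ⟨h1, ?_⟩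
      refine (contDiffAt_snd.contMDiffAt).congr_of_eventuallyEq ?_
      filter_upwards [(isOpen_slitTarget x₀).mem_nhds hz] with w hw
      have hw' : (extChartAt (𝓡 n) x₀).symm w.1
          ∈ (chartAt (EuclideanSpace ℝ (Fin n)) x₀).source := by
        simpa using (extChartAt (𝓡 n) x₀).map_target hw.1
      rw [← chartCoord_eq hw', chartCoord_symm hw']
    · simp only [Bundle.Trivialization.mem_source, hbb]
      exact hb

theorem localF_pos {x₀ : M} {z : EuclideanSpace ℝ (Fin n) × EuclideanSpace ℝ (Fin n)}
    (hz : z ∈ slitTarget n x₀) : 0 < 𝓕.localF x₀ z := by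
  obtain ⟨b, hb, v, hv, rfl⟩ := exists_of_mem_slitTarget hz
  rw [𝓕.localF_chartCoord hb]
  exact 𝓕.pos b v hv

theorem g_eq_gForm {x₀ b : M} (hb : b ∈ (chartAt (EuclideanSpace ℝ (Fin n)) x₀).source)
    {y : TangentSpace (𝓡 n) b} (hy : y ≠ 0) (u v : TangentSpace (𝓡 n) b) :
    𝓕.g y u v = gForm (𝓕.localF x₀) (extChartAt (𝓡 n) x₀ b, chartCoord x₀ b y)
      (chartCoord x₀ b u) (chartCoord x₀ b v) := by
  rw [← half_deriv_deriv_sq_eq_gForm (isOpen_slitTarget x₀) (𝓕.contDiffOn_localF x₀)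
    (mem_slitTarget hb hy)]
  simp only [g, fundTensor, ← map_smul, ← map_add, 𝓕.localF_chartCoord hb]

/-- A nonzero kernel vector of the matrix would be a nonzero tangent vector w with g(w, w) = 0,
against positive definiteness. -/
theorem isUnit_det_gLow {x₀ b : M} (hb : b ∈ (chartAt (EuclideanSpace ℝ (Fin n)) x₀).source)
    {y : TangentSpace (𝓡 n) b} (hy : y ≠ 0) :
    IsUnit (Matrix.of fun i j : Fin n =>
      gLow (𝓕.localF x₀) i j (extChartAt (𝓡 n) x₀ b, chartCoord x₀ b y)).det := by
  rw [isUnit_iff_ne_zero]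
  intro h0
  obtain ⟨v, hv, hGv⟩ := Matrix.exists_mulVec_eq_zero_iff.2 h0
  set V : EuclideanSpace ℝ (Fin n) := WithLp.toLp 2 v with hV
  have hV0 : V ≠ 0 := by
    intro h
    apply hv
    ext i
    exact congrArg (fun w : EuclideanSpace ℝ (Fin n) => w i) h
  set w := (trivializationAt (EuclideanSpace ℝ (Fin n)) (TangentSpace (𝓡 n)) x₀).symm b V with hw
  have hwV : chartCoord x₀ b w = V := chartCoord_symm hb V
  have hw0 : w ≠ 0 := by
    intro h
    rw [h, map_zero] at hwV
    exact hV0 hwV.symm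
  have hpos := 𝓕.posDef b y hy w hw0
  have hg := 𝓕.g_eq_gForm hb hy w w
  rw [g, hwV] at hg
  rw [hg, gForm] at hpos
  refine hpos.ne' (Finset.sum_eq_zero fun i _ => ?_)
  have := congrFun hGv i
  simp only [Matrix.mulVec, dotProduct, Matrix.of_apply, Pi.zero_apply] at this
  rw [hV]
  exact mul_eq_zero_of_right _ this

theorem nrm_eq_F {b : M} {y : TangentSpace (𝓡 n) b} (hy : y ≠ 0) :
    𝓕.nrm y y = 𝓕.F ⟨b, y⟩ := by
  have hb := mem_chart_source (EuclideanSpace ℝ (Fin n)) b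
  rw [nrm, 𝓕.g_eq_gForm hb hy, gForm_snd_snd (isOpen_slitTarget b) (𝓕.contDiffOn_localF b)
    (𝓕.localF_smul b) (mem_slitTarget hb hy), 𝓕.localF_chartCoord hb, Real.sqrt_sq
      (𝓕.pos b y hy).le]

theorem momentum_eq {x₀ b : M} (hb : b ∈ (chartAt (EuclideanSpace ℝ (Fin n)) x₀).source)
    {y : TangentSpace (𝓡 n) b} (hy : y ≠ 0) (u : TangentSpace (𝓡 n) b) (p : ℝ) :
    𝓕.momentum p y u = 𝓕.localF x₀ (extChartAt (𝓡 n) x₀ b, chartCoord x₀ b y) ^ (p - 2) *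
      gForm (𝓕.localF x₀) (extChartAt (𝓡 n) x₀ b, chartCoord x₀ b y) (chartCoord x₀ b u)
          (chartCoord x₀ b y) := by
  rw [momentum, 𝓕.g_eq_gForm hb hy, map_smul, gForm_smul_right, 𝓕.nrm_eq_F hy, 𝓕.localF_chartCoord hb]

theorem hasDerivAt_F_rpow {b : M} {y : TangentSpace (𝓡 n) b} (hy : y ≠ 0)
    (u : TangentSpace (𝓡 n) b) (p : ℝ) :
    HasDerivAt (fun r : ℝ => 𝓕.F ⟨b, y + r • u⟩ ^ p) (p * 𝓕.momentum p y u) 0 := by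
  have hb := mem_chart_source (EuclideanSpace ℝ (Fin n)) b
  have hz := mem_slitTarget hb hy
  have h := hasDerivAt_rpow_add_smul (isOpen_slitTarget b) (𝓕.contDiffOn_localF b)
    (𝓕.localF_smul b) hz (𝓕.localF_pos hz) (chartCoord b b u) p
  simp only [← map_smul, ← map_add] at h
  simp only [𝓕.localF_chartCoord hb] at h
  rwa [𝓕.momentum_eq hb hy, 𝓕.localF_chartCoord hb]

end FinslerMetric

end Coordinates

/-! ### Differentiation under the integral sign on a strip -/

section ParametricIntegral

theorem uniqueDiffOn_strip (ε : ℝ) {a b : ℝ} (hab : a < b) :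
    UniqueDiffOn ℝ (Ioo (-ε) ε ×ˢ Icc a b) :=
  (uniqueDiffOn_Ioo _ _).prod (uniqueDiffOn_Icc hab)

theorem hasDerivAt_fst_of_contDiffOn_strip {ε a b : ℝ} {l : ℝ × ℝ → ℝ}
    (hl : ContDiffOn ℝ ∞ l (Ioo (-ε) ε ×ˢ Icc a b)) {s t : ℝ} (hs : s ∈ Ioo (-ε) ε)
    (ht : t ∈ Icc a b) :
    HasDerivAt (fun s => l (s, t)) (fderivWithin ℝ l (Ioo (-ε) ε ×ˢ Icc a b) (s, t) (1, 0)) s := by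
  have h1 := ((hl.differentiableOn (by simp)) (s, t) ⟨hs, ht⟩).hasFDerivWithinAt
  have h2 : HasDerivWithinAt (fun s : ℝ => (s, t)) ((1 : ℝ), (0 : ℝ)) (Ioo (-ε) ε) s :=
    ((hasDerivAt_id s).prodMk (hasDerivAt_const _ _)).hasDerivWithinAt
  exact (h1.comp_hasDerivWithinAt s h2 (show MapsTo (fun s : ℝ => (s, t)) _
    (Ioo (-ε) ε ×ˢ Icc a b) from fun r hr => ⟨hr, ht⟩)).hasDerivAt (isOpen_Ioo.mem_nhds hs)

theorem hasDerivAt_integral_of_contDiffOn_strip {ε a b : ℝ} (hε : 0 < ε) (hab : a < b)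
    {l : ℝ × ℝ → ℝ} (hl : ContDiffOn ℝ ∞ l (Ioo (-ε) ε ×ˢ Icc a b)) :
    HasDerivAt (fun s => ∫ t in a..b, l (s, t)) (∫ t in a..b, deriv (fun s => l (s, t)) 0) 0 := by
  -- The strip is open in s, so the dominating constant is taken on the compact half strip |s| ≤
  -- ε/2.
  have hε2 : Icc (-(ε / 2)) (ε / 2) ⊆ Ioo (-ε) ε := fun s hs =>
    ⟨by linarith [hs.1], by linarith [hs.2]⟩
  have hball : Metric.ball (0 : ℝ) (ε / 2) ⊆ Icc (-(ε / 2)) (ε / 2) := by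
    rw [Real.ball_eq_Ioo, zero_sub, zero_add]
    exact Ioo_subset_Icc_self
  have hbm : Metric.ball (0 : ℝ) (ε / 2) ∈ nhds (0 : ℝ) := Metric.ball_mem_nhds _ (by linarith)
  have hsl : ∀ s ∈ Ioo (-ε) ε, ContinuousOn (fun t => l (s, t)) (Icc a b) := fun s hs =>
    hl.continuousOn.comp (by fun_prop) fun t ht => ⟨hs, ht⟩
  have hD : ContinuousOn
      (fun q => fderivWithin ℝ l (Ioo (-ε) ε ×ˢ Icc a b) q (1, 0)) (Ioo (-ε) ε ×ˢ Icc a b) :=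
    (hl.continuousOn_fderivWithin (uniqueDiffOn_strip ε hab) (by simp)).clm_apply
      continuousOn_const
  obtain ⟨C, hC⟩ := (isCompact_Icc.prod isCompact_Icc).exists_bound_of_continuousOn
    (hD.mono (prod_mono hε2 (Subset.refl (Icc a b))))
  have hsub : uIoc a b ⊆ Icc a b := by
    rw [uIoc_of_le hab.le]; exact Ioc_subset_Icc_self
  have h0 : (0 : ℝ) ∈ Ioo (-ε) ε := ⟨by linarith, hε⟩
  have hint : ∀ g : ℝ → ℝ, ContinuousOn g (Icc a b) → IntervalIntegrable g volume a b :=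
    fun g hg => ContinuousOn.intervalIntegrable (by rwa [uIcc_of_le hab.le])
  have hD0 : ContinuousOn
      (fun t => fderivWithin ℝ l (Ioo (-ε) ε ×ˢ Icc a b) (0, t) (1, 0)) (Icc a b) :=
    hD.comp (f := fun t : ℝ => ((0 : ℝ), t)) (by fun_prop) fun t ht => ⟨h0, ht⟩
  have key := (intervalIntegral.hasDerivAt_integral_of_dominated_loc_of_deriv_le (μ := volume)
    (F := fun s t => l (s, t)) (x₀ := 0) (a := a) (b := b) (s := Metric.ball (0 : ℝ) (ε / 2))
    (F' := fun s t => fderivWithin ℝ l (Ioo (-ε) ε ×ˢ Icc a b) (s, t) (1, 0))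
    (bound := fun _ => C) hbm ?_ ?_ ?_ ?_ ?_ ?_).2
  · refine key.congr_deriv (intervalIntegral.integral_congr fun t ht => ?_)
    rw [uIcc_of_le hab.le] at ht
    exact (hasDerivAt_fst_of_contDiffOn_strip hl h0 ht).deriv.symm
  · filter_upwards [hbm] with s hs
    exact (hint _ (hsl s (hε2 (hball hs)))).def'.aestronglyMeasurable
  · exact hint _ (hsl 0 h0)
  · exact (hint _ hD0).def'.aestronglyMeasurable
  · exact Filter.Eventually.of_forall fun t ht s hs => hC (s, t) ⟨hball hs, hsub ht⟩
  · exact intervalIntegrable_const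
  · exact Filter.Eventually.of_forall fun t ht s hs =>
      hasDerivAt_fst_of_contDiffOn_strip hl (hε2 (hball hs)) (hsub ht)

/-- Differentiation under the integral sign, followed by an integration by parts. -/
theorem hasDerivAt_integral_of_hasDerivAt_momentum {ε a b : ℝ} (hε : 0 < ε) (hab : a < b)
    {l : ℝ × ℝ → ℝ} (hl : ContDiffOn ℝ ∞ l (Ioo (-ε) ε ×ˢ Icc a b)) {m j : ℝ → ℝ} {p : ℝ}
    (hp : p ≠ 0) (hm : ContDiffOn ℝ ∞ m (Icc a b))
    (hder : ∀ t ∈ Ioo a b, HasDerivAt m (deriv (fun s => l (s, t)) 0 + p * j t) t) :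
    IntervalIntegrable j volume a b ∧
      HasDerivAt (fun s => ∫ t in a..b, l (s, t)) (m b - m a - p * ∫ t in a..b, j t) 0 := by
  have h0 : (0 : ℝ) ∈ Ioo (-ε) ε := ⟨by linarith, hε⟩
  have hD : ContinuousOn (fun t => deriv (fun s => l (s, t)) 0) (Icc a b) := by
    have h : ContinuousOn
        (fun q => fderivWithin ℝ l (Ioo (-ε) ε ×ˢ Icc a b) q (1, 0)) (Ioo (-ε) ε ×ˢ Icc a b) :=
      (hl.continuousOn_fderivWithin (uniqueDiffOn_strip ε hab) (by simp)).clm_apply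
        continuousOn_const
    refine (h.comp (f := fun t : ℝ => ((0 : ℝ), t)) (by fun_prop)
      fun t ht => ⟨h0, ht⟩).congr fun t ht => ?_
    exact (hasDerivAt_fst_of_contDiffOn_strip hl h0 ht).deriv
  have hint : ∀ g : ℝ → ℝ, ContinuousOn g (Icc a b) → IntervalIntegrable g volume a b :=
    fun g hg => ContinuousOn.intervalIntegrable (by rwa [uIcc_of_le hab.le])
  have hm' : ContinuousOn (derivWithin m (Icc a b)) (Icc a b) :=
    hm.continuousOn_derivWithin (uniqueDiffOn_Icc hab) (by simp)
  -- On the open interval j equals (m' - ∂l/∂s)/p, whose right side is continuous up to the ends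
  -- when m' is the derivative within [a, b]. The values of j at the ends are not controlled and do
  -- not matter.
  have hj : IntervalIntegrable j volume a b := by
    have h := (hint _ ((hm'.sub hD).div_const p))
    rw [intervalIntegrable_iff_integrableOn_Ioo_of_le hab.le] at h ⊢
    refine h.congr_fun (fun t ht => ?_) measurableSet_Ioo
    have := (hder t ht).hasDerivWithinAt (s := Icc a b)
    simp only [Pi.sub_apply,
      this.derivWithin (uniqueDiffOn_Icc hab t (Ioo_subset_Icc_self ht))]
    field_simp
    ring
  refine ⟨hj, (hasDerivAt_integral_of_contDiffOn_strip hε hab hl).congr_deriv ?_⟩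
  have hFTC := intervalIntegral.integral_eq_sub_of_hasDerivAt_of_le hab.le hm.continuousOn hder
    ((hint _ hD).add (hj.const_mul p))
  rw [intervalIntegral.integral_add (hint _ hD) (hj.const_mul p),
    intervalIntegral.integral_const_mul] at hFTC
  linarith

end ParametricIntegral

/-! ### Smoothness of the energy density and of the momentum up to the ends of a piece -/

section Strip

variable {n : ℕ} {M : Type*} [TopologicalSpace M] [ChartedSpace (EuclideanSpace ℝ (Fin n)) M]
  [IsManifold (𝓡 n) ∞ M]

theorem clm_apply_pair_one (T : ℝ × ℝ →L[ℝ] EuclideanSpace ℝ (Fin n)) (r : ℝ) :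
    T (r, 1) = T (0, 1) + r • T (1, 0) := by
  rw [← map_smul, ← map_add]
  simp

namespace FinslerMetric

variable (𝓕 : FinslerMetric n M)

/-- F^p composed with the tangent map of G is smooth wherever that map avoids the zero section.
Keeping the tangent direction as a second variable allows it to be varied independently of the base
point. -/
theorem contDiffWithinAt_F_mfderivWithin {E' : Type*} [NormedAddCommGroup E'] [NormedSpace ℝ E']
    {G : E' → M} {U : Set E'} (hU : UniqueDiffOn ℝ U)
    (hG : ContMDiffOn 𝓘(ℝ, E') (𝓡 n) ∞ G U) {q w : E'} (hq : q ∈ U)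
    (hw : mfderivWithin 𝓘(ℝ, E') (𝓡 n) G U q w ≠ 0) (p : ℝ) :
    ContDiffWithinAt ℝ ∞
      (fun z : E' × E' => 𝓕.F ⟨G z.1, mfderivWithin 𝓘(ℝ, E') (𝓡 n) G U z.1 z.2⟩ ^ p)
      (U ×ˢ univ) (q, w) := by
  have := isManifold_one_of_infty n M
  have hT : ContMDiffWithinAt 𝓘(ℝ, E').tangent (𝓡 n).tangent ∞
      (tangentMapWithin 𝓘(ℝ, E') (𝓡 n) G U)
      (Bundle.TotalSpace.proj ⁻¹' U) (⟨q, w⟩ : TangentBundle 𝓘(ℝ, E') E') :=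
    hG.contMDiffOn_tangentMapWithin (by simp) hU.uniqueMDiffOn _ hq
  have hI : ContMDiffAt 𝓘(ℝ, E' × E') 𝓘(ℝ, E').tangent ∞
      (fun z : E' × E' => (⟨z.1, z.2⟩ : TangentBundle 𝓘(ℝ, E') E')) (q, w) := by
    rw [Bundle.contMDiffAt_totalSpace]
    refine ⟨contDiffAt_fst.contMDiffAt, ?_⟩
    simp only [trivializationAt_model_space_apply]
    exact contDiffAt_snd.contMDiffAt
  have hF : ContMDiffAt (𝓡 n).tangent 𝓘(ℝ, ℝ) ∞ 𝓕.F
      (tangentMapWithin 𝓘(ℝ, E') (𝓡 n) G U (⟨q, w⟩ : TangentBundle 𝓘(ℝ, E') E')) :=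
    𝓕.contMDiffAt_F hw
  have h : ContDiffWithinAt ℝ ∞
      (fun z : E' × E' => 𝓕.F ⟨G z.1, mfderivWithin 𝓘(ℝ, E') (𝓡 n) G U z.1 z.2⟩)
      (U ×ˢ univ) (q, w) := by
    rw [← contMDiffWithinAt_iff_contDiffWithinAt]
    exact ContMDiffWithinAt.comp (t := Bundle.TotalSpace.proj ⁻¹' U) (q, w)
      (hF.comp_contMDiffWithinAt _ hT) hI.contMDiffWithinAt
      (show MapsTo _ (U ×ˢ univ) _ from fun z hz => hz.1)
  exact h.rpow_const_of_ne (𝓕.pos _ _ hw).ne'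

theorem contDiffOn_F_mfderivWithin {ε a b : ℝ} (hab : a < b) {G : ℝ × ℝ → M}
    (hG : ContMDiffOn 𝓘(ℝ, ℝ × ℝ) (𝓡 n) ∞ G (Ioo (-ε) ε ×ˢ Icc a b))
    (hreg : ∀ q ∈ Ioo (-ε) ε ×ˢ Icc a b,
      mfderivWithin 𝓘(ℝ, ℝ × ℝ) (𝓡 n) G (Ioo (-ε) ε ×ˢ Icc a b) q ((0 : ℝ), (1 : ℝ)) ≠ 0)
    (p : ℝ) :
    ContDiffOn ℝ ∞ (fun q => 𝓕.F ⟨G q,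
      mfderivWithin 𝓘(ℝ, ℝ × ℝ) (𝓡 n) G (Ioo (-ε) ε ×ˢ Icc a b) q ((0 : ℝ), (1 : ℝ))⟩ ^ p)
      (Ioo (-ε) ε ×ˢ Icc a b) := by
  intro q hq
  exact (𝓕.contDiffWithinAt_F_mfderivWithin (uniqueDiffOn_strip ε hab) hG hq
    (hreg q hq) p).comp (f := fun q : ℝ × ℝ => (q, ((0 : ℝ), (1 : ℝ)))) q
    (contDiffWithinAt_id.prodMk contDiffWithinAt_const) fun r hr => ⟨hr, mem_univ _⟩

/-- No chart is used: p times the momentum is the r-derivative at r = 0 of F(∂G/∂t + r ∂G/∂s)^p, and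
this function of (t, r) is smooth near r = 0 up to t = a and t = b. -/
theorem contDiffOn_momentum {ε a b : ℝ} (hε : 0 < ε) (hab : a < b) {G : ℝ × ℝ → M}
    (hG : ContMDiffOn 𝓘(ℝ, ℝ × ℝ) (𝓡 n) ∞ G (Ioo (-ε) ε ×ˢ Icc a b))
    (hreg : ∀ q ∈ Ioo (-ε) ε ×ˢ Icc a b,
      mfderivWithin 𝓘(ℝ, ℝ × ℝ) (𝓡 n) G (Ioo (-ε) ε ×ˢ Icc a b) q ((0 : ℝ), (1 : ℝ)) ≠ 0)
    (p : ℝ) :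
    ContDiffOn ℝ ∞ (fun t => p * 𝓕.momentum p
      (mfderivWithin 𝓘(ℝ, ℝ × ℝ) (𝓡 n) G (Ioo (-ε) ε ×ˢ Icc a b) (0, t) ((0 : ℝ), (1 : ℝ)))
      (mfderivWithin 𝓘(ℝ, ℝ × ℝ) (𝓡 n) G (Ioo (-ε) ε ×ˢ Icc a b) (0, t) ((1 : ℝ), (0 : ℝ))))
      (Icc a b) := by
  have h0 : (0 : ℝ) ∈ Ioo (-ε) ε := ⟨by linarith, hε⟩
  set U := Ioo (-ε) ε ×ˢ Icc a b with hU
  set K : ℝ × ℝ → ℝ := fun z => 𝓕.F ⟨G (0, z.1),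
    mfderivWithin 𝓘(ℝ, ℝ × ℝ) (𝓡 n) G U (0, z.1) (z.2, (1 : ℝ))⟩ ^ p with hK
  have hsm : ∀ t ∈ Icc a b, ContDiffWithinAt ℝ ∞ K (Icc a b ×ˢ univ) (t, 0) := by
    intro t ht
    have h := 𝓕.contDiffWithinAt_F_mfderivWithin (uniqueDiffOn_strip ε hab) hG
      (q := (0, t)) (w := (0, 1)) ⟨h0, ht⟩ (hreg _ ⟨h0, ht⟩) p
    refine h.comp (f := fun z : ℝ × ℝ => (((0 : ℝ), z.1), (z.2, (1 : ℝ)))) (t, 0) ?_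
      fun z hz => ⟨⟨h0, hz.1⟩, mem_univ _⟩
    exact ContDiff.contDiffWithinAt (by fun_prop)
  have hud : UniqueDiffOn ℝ (Icc a b ×ˢ (univ : Set ℝ)) :=
    (uniqueDiffOn_Icc hab).prod uniqueDiffOn_univ
  intro t ht
  have hfd : ContDiffWithinAt ℝ ∞ (fun t => fderivWithin ℝ K (Icc a b ×ˢ univ) (t, 0) (0, 1))
      (Icc a b) t :=
    (((hsm t ht).fderivWithin_right hud (by simp) ⟨ht, mem_univ _⟩).comp
      (f := fun t : ℝ => (t, (0 : ℝ))) t (ContDiff.contDiffWithinAt (by fun_prop))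
      fun r hr => ⟨hr, mem_univ _⟩).clm_apply contDiffWithinAt_const
  have heq : ∀ t ∈ Icc a b, p * 𝓕.momentum p
      (mfderivWithin 𝓘(ℝ, ℝ × ℝ) (𝓡 n) G U (0, t) ((0 : ℝ), (1 : ℝ)))
      (mfderivWithin 𝓘(ℝ, ℝ × ℝ) (𝓡 n) G U (0, t) ((1 : ℝ), (0 : ℝ)))
      = fderivWithin ℝ K (Icc a b ×ˢ univ) (t, 0) (0, 1) := by
    intro t ht
    have h1 := 𝓕.hasDerivAt_F_rpow (hreg _ ⟨h0, ht⟩)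
      (mfderivWithin 𝓘(ℝ, ℝ × ℝ) (𝓡 n) G U (0, t) ((1 : ℝ), (0 : ℝ))) p
    have h2 : HasDerivAt (fun r : ℝ => K (t, r))
        (fderivWithin ℝ K (Icc a b ×ˢ univ) (t, 0) (0, 1)) 0 := by
      have hl : HasDerivWithinAt (fun r : ℝ => (t, r)) ((0 : ℝ), (1 : ℝ)) univ 0 :=
        ((hasDerivAt_const _ _).prodMk (hasDerivAt_id (0 : ℝ))).hasDerivWithinAt
      have := ((hsm t ht).differentiableWithinAt (by simp)).hasFDerivWithinAt.comp_hasDerivWithinAt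
        (0 : ℝ) hl (show MapsTo (fun r : ℝ => (t, r)) univ (Icc a b ×ˢ univ) from
          fun r _ => ⟨ht, mem_univ _⟩)
      exact hasDerivWithinAt_univ.1 this
    refine h1.unique (h2.congr_of_eventuallyEq (Filter.Eventually.of_forall fun r => ?_))
    exact (congrArg (fun v : TangentSpace (𝓡 n) (G (0, t)) => 𝓕.F ⟨G (0, t), v⟩ ^ p)
      (clm_apply_pair_one (mfderivWithin 𝓘(ℝ, ℝ × ℝ) (𝓡 n) G U (0, t)) r)).symm
  exact hfd.congr heq (heq t ht)

end FinslerMetric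

end Strip

/-! ### Velocity and variation field as partial derivatives; the first variation on the manifold -/

section Slices

variable {n : ℕ} {M : Type*} [TopologicalSpace M] [ChartedSpace (EuclideanSpace ℝ (Fin n)) M]

theorem velocityWithin_eq {c : ℝ → M} {I J : Set ℝ} {t : ℝ}
    {T : TangentSpace 𝓘(ℝ, ℝ) t →L[ℝ] TangentSpace (𝓡 n) (c t)}
    (h : HasMFDerivWithinAt 𝓘(ℝ, ℝ) (𝓡 n) c J t T) (hJ : J ∈ nhdsWithin t I)
    (hI : UniqueDiffWithinAt ℝ I t) : velocityWithin c I t = T (1 : ℝ) := by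
  rw [velocityWithin, (h.mono_of_mem_nhdsWithin hJ).mfderivWithin hI.uniqueMDiffWithinAt]

theorem velocity_eq {c : ℝ → M} {J : Set ℝ} {t : ℝ}
    {T : TangentSpace 𝓘(ℝ, ℝ) t →L[ℝ] TangentSpace (𝓡 n) (c t)}
    (h : HasMFDerivWithinAt 𝓘(ℝ, ℝ) (𝓡 n) c J t T) (hJ : J ∈ nhds t) :
    velocity c t = T (1 : ℝ) := by
  rw [velocity, (h.hasMFDerivAt hJ).mfderiv]

theorem covDerivLocal_congr (f : EuclideanSpace ℝ (Fin n) × EuclideanSpace ℝ (Fin n) → ℝ)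
    (x : ℝ → EuclideanSpace ℝ (Fin n)) {X X' : ℝ → EuclideanSpace ℝ (Fin n)} {t : ℝ}
    (h : X =ᶠ[nhds t] X') : covDerivLocal f x X t = covDerivLocal f x X' t := by
  simp only [covDerivLocal, h.deriv_eq, h.eq_of_nhds]

variable {ε a b : ℝ} {G : ℝ × ℝ → M}

theorem hasMFDerivWithinAt_snd_slice
    (hG : ContMDiffOn 𝓘(ℝ, ℝ × ℝ) (𝓡 n) ∞ G (Ioo (-ε) ε ×ˢ Icc a b)) {s t : ℝ}
    (hs : s ∈ Ioo (-ε) ε) (ht : t ∈ Icc a b) :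
    HasMFDerivWithinAt 𝓘(ℝ, ℝ) (𝓡 n) (fun τ => G (s, τ)) (Icc a b) t
      ((mfderivWithin 𝓘(ℝ, ℝ × ℝ) (𝓡 n) G (Ioo (-ε) ε ×ˢ Icc a b) (s, t)).comp
        (ContinuousLinearMap.inr ℝ ℝ ℝ)) := by
  have h1 := ((hG (s, t) ⟨hs, ht⟩).mdifferentiableWithinAt (by simp)).hasMFDerivWithinAt
  have h2 : HasFDerivWithinAt (fun τ : ℝ => (s, τ)) (ContinuousLinearMap.inr ℝ ℝ ℝ)
      (Icc a b) t := (hasFDerivAt_prodMk_right s t).hasFDerivWithinAt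
  exact h1.comp t h2.hasMFDerivWithinAt fun r hr => ⟨hs, hr⟩

theorem hasMFDerivAt_fst_slice
    (hG : ContMDiffOn 𝓘(ℝ, ℝ × ℝ) (𝓡 n) ∞ G (Ioo (-ε) ε ×ˢ Icc a b)) {s t : ℝ}
    (hs : s ∈ Ioo (-ε) ε) (ht : t ∈ Icc a b) :
    HasMFDerivAt 𝓘(ℝ, ℝ) (𝓡 n) (fun σ => G (σ, t)) s
      ((mfderivWithin 𝓘(ℝ, ℝ × ℝ) (𝓡 n) G (Ioo (-ε) ε ×ˢ Icc a b) (s, t)).comp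
        (ContinuousLinearMap.inl ℝ ℝ ℝ)) := by
  have h1 := ((hG (s, t) ⟨hs, ht⟩).mdifferentiableWithinAt (by simp)).hasMFDerivWithinAt
  have h2 : HasFDerivWithinAt (fun σ : ℝ => (σ, t)) (ContinuousLinearMap.inl ℝ ℝ ℝ)
      (Ioo (-ε) ε) s := (hasFDerivAt_prodMk_left s t).hasFDerivWithinAt
  exact
      (h1.comp s h2.hasMFDerivWithinAt (show Ioo (-ε) ε ⊆ (fun σ : ℝ => (σ, t)) ⁻¹' (Ioo (-ε) ε ×ˢ Icc a b) from
    fun r hr => ⟨hr, ht⟩)).hasMFDerivAt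
    (isOpen_Ioo.mem_nhds hs)

theorem velocity_slice
    (hG : ContMDiffOn 𝓘(ℝ, ℝ × ℝ) (𝓡 n) ∞ G (Ioo (-ε) ε ×ˢ Icc a b)) {s t : ℝ}
    (hs : s ∈ Ioo (-ε) ε) (ht : t ∈ Ioo a b) :
    velocity (fun τ => G (s, τ)) t = mfderivWithin 𝓘(ℝ, ℝ × ℝ) (𝓡 n) G
      (Ioo (-ε) ε ×ˢ Icc a b) (s, t) ((0 : ℝ), (1 : ℝ)) :=
  velocity_eq (hasMFDerivWithinAt_snd_slice hG hs (Ioo_subset_Icc_self ht))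
    (Icc_mem_nhds ht.1 ht.2)

theorem velocityWithin_slice
    (hG : ContMDiffOn 𝓘(ℝ, ℝ × ℝ) (𝓡 n) ∞ G (Ioo (-ε) ε ×ˢ Icc a b)) {s t : ℝ}
    (hs : s ∈ Ioo (-ε) ε) (ht : t ∈ Icc a b) {I : Set ℝ} (hJ : Icc a b ∈ nhdsWithin t I)
    (hI : UniqueDiffWithinAt ℝ I t) :
    velocityWithin (fun τ => G (s, τ)) I t = mfderivWithin 𝓘(ℝ, ℝ × ℝ) (𝓡 n) G
      (Ioo (-ε) ε ×ˢ Icc a b) (s, t) ((0 : ℝ), (1 : ℝ)) :=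
  velocityWithin_eq (hasMFDerivWithinAt_snd_slice hG hs ht) hJ hI

theorem variationField_slice (hε : 0 < ε)
    (hG : ContMDiffOn 𝓘(ℝ, ℝ × ℝ) (𝓡 n) ∞ G (Ioo (-ε) ε ×ˢ Icc a b)) {t : ℝ}
    (ht : t ∈ Icc a b) :
    variationField (fun σ τ => G (σ, τ)) t = mfderivWithin 𝓘(ℝ, ℝ × ℝ) (𝓡 n) G
      (Ioo (-ε) ε ×ˢ Icc a b) (0, t) ((1 : ℝ), (0 : ℝ)) := by
  rw [variationField, (hasMFDerivAt_fst_slice hG ⟨by linarith, hε⟩ ht).mfderiv]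
  rfl

namespace FinslerMetric

variable [IsManifold (𝓡 n) ∞ M] (𝓕 : FinslerMetric n M)

/-- The first variation formula for `‖ċ‖ᵖ` at an interior parameter of a smooth piece. -/
theorem hasDerivAt_momentum (hε : 0 < ε)
    (hG : ContMDiffOn 𝓘(ℝ, ℝ × ℝ) (𝓡 n) ∞ G (Ioo (-ε) ε ×ˢ Icc a b))
    (hreg : ∀ q ∈ Ioo (-ε) ε ×ˢ Icc a b,
      mfderivWithin 𝓘(ℝ, ℝ × ℝ) (𝓡 n) G (Ioo (-ε) ε ×ˢ Icc a b) q ((0 : ℝ), (1 : ℝ)) ≠ 0)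
    (p : ℝ) {t : ℝ} (ht : t ∈ Ioo a b) :
    HasDerivAt (fun τ => p * 𝓕.momentum p
      (mfderivWithin 𝓘(ℝ, ℝ × ℝ) (𝓡 n) G (Ioo (-ε) ε ×ˢ Icc a b) (0, τ) ((0 : ℝ), (1 : ℝ)))
      (mfderivWithin 𝓘(ℝ, ℝ × ℝ) (𝓡 n) G (Ioo (-ε) ε ×ˢ Icc a b) (0, τ) ((1 : ℝ), (0 : ℝ))))
      (deriv (fun s => 𝓕.F ⟨G (s, t), mfderivWithin 𝓘(ℝ, ℝ × ℝ) (𝓡 n) G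
          (Ioo (-ε) ε ×ˢ Icc a b) (s, t) ((0 : ℝ), (1 : ℝ))⟩ ^ p) 0
        + p * 𝓕.variationIntegrand p (fun τ => G (0, τ)) t
          (mfderivWithin 𝓘(ℝ, ℝ × ℝ) (𝓡 n) G (Ioo (-ε) ε ×ˢ Icc a b) (0, t)
            ((1 : ℝ), (0 : ℝ)))) t := by
  have h0 : (0 : ℝ) ∈ Ioo (-ε) ε := ⟨by linarith, hε⟩
  set U := Ioo (-ε) ε ×ˢ Icc a b with hU
  -- The chart is the one centred at c(t), in which the covariant derivative at t is defined. It
  -- covers the nearby points, which suffices for derivatives at t.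
  set x₀ := G (0, t) with hx₀
  set u : ℝ × ℝ → EuclideanSpace ℝ (Fin n) := fun q => extChartAt (𝓡 n) x₀ (G q) with hu
  have hO : IsOpen (Ioo (-ε) ε ×ˢ Ioo a b) := isOpen_Ioo.prod isOpen_Ioo
  have hOU : Ioo (-ε) ε ×ˢ Ioo a b ⊆ U := prod_mono (Subset.refl _) Ioo_subset_Icc_self
  have hUn : ∀ q ∈ Ioo (-ε) ε ×ˢ Ioo a b, U ∈ nhds q := fun q hq =>
    Filter.mem_of_superset (hO.mem_nhds hq) hOU
  have hG0 : ContMDiffAt 𝓘(ℝ, ℝ × ℝ) (𝓡 n) ∞ G (0, t) := hG.contMDiffAt (hUn _ ⟨h0, ht⟩)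
  have hsrc : ∀ᶠ q in nhds ((0 : ℝ), t), q ∈ U ∧
      G q ∈ (chartAt (EuclideanSpace ℝ (Fin n)) x₀).source ∧
      ∀ r r' : ℝ, chartCoord x₀ (G q) (mfderivWithin 𝓘(ℝ, ℝ × ℝ) (𝓡 n) G U q (r, r'))
        = fderiv ℝ u q (r, r') := by
    filter_upwards [hO.mem_nhds ⟨h0, ht⟩, hG0.continuousAt.preimage_mem_nhds
      ((chartAt (EuclideanSpace ℝ (Fin n)) x₀).open_source.mem_nhds
        (mem_chart_source (EuclideanSpace ℝ (Fin n)) x₀))] with q hq hq'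
    refine ⟨hOU hq, hq', fun r r' => ?_⟩
    rw [mfderivWithin_of_mem_nhds (hUn q hq)]
    exact chartCoord_mfderiv hq' ((hG.contMDiffAt (hUn q hq)).mdifferentiableAt (by simp)) (r, r')
  have hu0 : ContDiffAt ℝ ∞ u (0, t) := by
    rw [← contMDiffAt_iff_contDiffAt]
    exact (contMDiffAt_extChartAt (I := 𝓡 n) (x := x₀)).comp ((0 : ℝ), t) hG0
  obtain ⟨hq0, hsrc0, hcc⟩ := hsrc.self_of_nhds
  have hy := hreg (0, t) hq0
  have hz := mem_slitTarget hsrc0 hy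
  have hpos := 𝓕.localF_pos hz
  have hdet := 𝓕.isUnit_det_gLow hsrc0 hy
  have hF := 𝓕.localF_chartCoord hsrc0
    (mfderivWithin 𝓘(ℝ, ℝ × ℝ) (𝓡 n) G U (0, t) ((0 : ℝ), (1 : ℝ)))
  rw [hcc] at hz hpos hdet hF
  have key := hasDerivAt_momentum_local (isOpen_slitTarget x₀) (𝓕.contDiffOn_localF x₀)
    (𝓕.localF_smul x₀) hu0 hz hpos hdet p
  have hl : Filter.Tendsto (fun τ : ℝ => ((0 : ℝ), τ)) (nhds t) (nhds (0, t)) :=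
    (Continuous.continuousAt (by fun_prop))
  have hl' : Filter.Tendsto (fun s : ℝ => (s, t)) (nhds 0) (nhds (0, t)) :=
    (Continuous.continuousAt (by fun_prop))
  refine (key.congr_of_eventuallyEq ?_).congr_deriv ?_
  · filter_upwards [hl.eventually hsrc] with τ hτ
    rw [𝓕.momentum_eq hτ.2.1 (hreg _ hτ.1), hτ.2.2, hτ.2.2]
  · have hvel : velocity (fun τ => G (0, τ)) t
        = mfderivWithin 𝓘(ℝ, ℝ × ℝ) (𝓡 n) G U (0, t) ((0 : ℝ), (1 : ℝ)) :=
      velocity_slice hG h0 ht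
    have hcov : chartCoord x₀ x₀ (𝓕.covDeriv (fun τ => G (0, τ)) (velocity fun τ => G (0, τ)) t)
        = covDerivLocal (𝓕.localF x₀) (fun τ => u (0, τ)) (deriv fun τ => u (0, τ)) t := by
      rw [covDeriv, chartCoord_symm hsrc0]
      -- The components of the velocity agree with the coordinate derivative only near t, and the
      -- covariant derivative depends only on that germ.
      refine covDerivLocal_congr _ _ ?_
      filter_upwards [hl.eventually hsrc, Ioo_mem_nhds ht.1 ht.2] with τ hτ hτ'
      rw [← chartCoord_eq hτ.2.1]
      exact chartCoord_mfderiv (G := fun τ => G (0, τ)) hτ.2.1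
        ((hasMFDerivWithinAt_snd_slice hG h0 hτ.1.2).hasMFDerivAt
          (Icc_mem_nhds hτ'.1 hτ'.2)).mdifferentiableAt (1 : ℝ)
    congr 1
    · refine Filter.EventuallyEq.deriv_eq ?_
      filter_upwards [hl'.eventually hsrc] with s hs
      rw [← 𝓕.localF_chartCoord hs.2.1, hs.2.2]
    · rw [variationIntegrand, hvel, 𝓕.nrm_eq_F hy, ← hF, 𝓕.g_eq_gForm hsrc0 hy,
        𝓕.g_eq_gForm hsrc0 hy, map_add, map_smul, map_smul, hcc, hcc, hcov]

end FinslerMetric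

end Slices

/-! ### Smooth pieces and their concatenation -/

section Pieces

variable {n : ℕ} {M : Type*} [TopologicalSpace M] [ChartedSpace (EuclideanSpace ℝ (Fin n)) M]
  {ε a b : ℝ} {G : ℝ × ℝ → M}

/-- The break points of the individual curve need not be those of the variation. Still, a short
interval with end point t, to the right of t or, at t = b, to the left, has none of them in its
interior, and its one-sided velocity at t is the t-derivative of G in the strip. -/
theorem IsAdmissible.mfderivWithin_ne_zero {x₀ x₁ : M} (ha : 0 ≤ a) (hab : a < b) (hb : b ≤ 1)
    (hG : ContMDiffOn 𝓘(ℝ, ℝ × ℝ) (𝓡 n) ∞ G (Ioo (-ε) ε ×ˢ Icc a b)) {s t : ℝ}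
    (hs : s ∈ Ioo (-ε) ε) (hadm : IsAdmissible n x₀ x₁ fun τ => G (s, τ)) (ht : t ∈ Icc a b) :
    mfderivWithin 𝓘(ℝ, ℝ × ℝ) (𝓡 n) G (Ioo (-ε) ε ×ˢ Icc a b) (s, t) ((0 : ℝ), (1 : ℝ)) ≠ 0 := by
  obtain ⟨-, -, S, -, hS⟩ := hadm
  -- The point t itself may be a break point of this curve; it is harmless as an end of the
  -- interval, so it is erased.
  have hmem : ((S.erase t : Finset ℝ) : Set ℝ)ᶜ ∈ nhds t :=
    (S.erase t).finite_toSet.isClosed.isOpen_compl.mem_nhds (by simp)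
  rcases lt_or_ge t b with htb | htb
  · obtain ⟨d, hd, hsub⟩ := exists_Ico_subset_of_mem_nhds hmem ⟨b, htb⟩
    have htd : t < min d b := lt_min hd htb
    have hdis : Disjoint (Ioo t (min d b)) (S : Set ℝ) := by
      rw [Set.disjoint_left]
      intro r hr hrS
      exact hsub ⟨hr.1.le, hr.2.trans_le (min_le_left _ _)⟩
        (Finset.mem_coe.2 (Finset.mem_erase.2 ⟨hr.1.ne', hrS⟩))
    have h := (hS t (min d b) (ha.trans ht.1) htd ((min_le_right _ _).trans hb) hdis).2 t
      ⟨le_rfl, htd.le⟩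
    rwa [velocityWithin_slice hG hs ht (Filter.mem_of_superset self_mem_nhdsWithin
      (Icc_subset_Icc ht.1 (min_le_right _ _)))
      (uniqueDiffOn_Icc htd t ⟨le_rfl, htd.le⟩)] at h
  · have hta : a < t := hab.trans_le htb
    obtain ⟨d, hd, hsub⟩ := exists_Ioc_subset_of_mem_nhds hmem ⟨a, hta⟩
    have htd : max d a < t := max_lt hd hta
    have hdis : Disjoint (Ioo (max d a) t) (S : Set ℝ) := by
      rw [Set.disjoint_left]
      intro r hr hrS
      exact hsub ⟨(le_max_left _ _).trans_lt hr.1, hr.2.le⟩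
        (Finset.mem_coe.2 (Finset.mem_erase.2 ⟨hr.2.ne, hrS⟩))
    have h := (hS (max d a) t (ha.trans (le_max_right _ _)) htd (ht.2.trans hb) hdis).2 t
      ⟨htd.le, le_rfl⟩
    rwa [velocityWithin_slice hG hs ht (Filter.mem_of_superset self_mem_nhdsWithin
      (Icc_subset_Icc (le_max_right _ _) ht.2))
      (uniqueDiffOn_Icc htd t ⟨htd.le, le_rfl⟩)] at h

theorem variationField_eq_zero {Γ : ℝ → ℝ → M} (hε : 0 < ε) {t : ℝ} {x : M}
    (h : ∀ s ∈ Ioo (-ε) ε, Γ s t = x) : variationField (n := n) Γ t = 0 := by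
  have he : (fun s => Γ s t) =ᶠ[nhds 0] fun _ => x := by
    filter_upwards [isOpen_Ioo.mem_nhds (show (0 : ℝ) ∈ Ioo (-ε) ε from ⟨by linarith, hε⟩)]
      with s hs using h s hs
  have hd : HasMFDerivAt 𝓘(ℝ, ℝ) (𝓡 n) (fun s => Γ s t) 0 0 :=
    (hasMFDerivAt_const x (0 : ℝ)).congr_of_eventuallyEq he
  rw [variationField, hd.mfderiv]
  rfl

/-- Off S the point t lies inside a smooth piece, where both one-sided velocities equal the
t-derivative in the strip. -/
theorem velocityWithin_Ici_eq_Iic (hε : 0 < ε) {Γ : ℝ → ℝ → M} {S : Finset ℝ}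
    (hS : ∀ a b : ℝ, 0 ≤ a → a < b → b ≤ 1 → Disjoint (Ioo a b) (S : Set ℝ) →
      ContMDiffOn 𝓘(ℝ, ℝ × ℝ) (𝓡 n) ∞ (fun q : ℝ × ℝ => Γ q.1 q.2) (Ioo (-ε) ε ×ˢ Icc a b))
    {t : ℝ} (ht : t ∈ Ioo (0 : ℝ) 1) (htS : t ∉ S) :
    velocityWithin (n := n) (Γ 0) (Ici t) t = velocityWithin (Γ 0) (Iic t) t := by
  have hmem : (S : Set ℝ)ᶜ ∩ Ioo 0 1 ∈ nhds t :=
    Filter.inter_mem (S.finite_toSet.isClosed.isOpen_compl.mem_nhds htS)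
      (isOpen_Ioo.mem_nhds ht)
  obtain ⟨a, b, htab, hsub⟩ := mem_nhds_iff_exists_Ioo_subset.1 hmem
  have hab : a < b := htab.1.trans htab.2
  have h01 := (Ioo_subset_Ioo_iff hab).1 (hsub.trans inter_subset_right)
  have hG := hS a b h01.1 hab h01.2
    (Set.disjoint_left.2 fun r hr hrS => (hsub hr).1 hrS)
  have h0 : (0 : ℝ) ∈ Ioo (-ε) ε := ⟨by linarith, hε⟩
  have hn := Icc_mem_nhds htab.1 htab.2
  have h1 := velocityWithin_slice hG h0 (Ioo_subset_Icc_self htab) (mem_nhdsWithin_of_mem_nhds hn)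
    (uniqueDiffOn_Ici t t self_mem_Ici)
  have h2 := velocityWithin_slice hG h0 (Ioo_subset_Icc_self htab) (mem_nhdsWithin_of_mem_nhds hn)
    (uniqueDiffOn_Iic t t self_mem_Iic)
  exact h1.trans h2.symm

variable [IsManifold (𝓡 n) ∞ M] (𝓕 : FinslerMetric n M) (p : ℝ) (Γ : ℝ → ℝ → M)

/-- The first variation formula for the variation `Γ` on the parameter interval `[a, b]`, with
break points in `S`. -/
def HasFirstVariationOn (ε : ℝ) (S : Finset ℝ) (a b : ℝ) : Prop :=
  (∀ s ∈ Ioo (-ε) ε, IntervalIntegrable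
    (fun t => 𝓕.nrm (velocity (Γ s) t) (velocity (Γ s) t) ^ p) volume a b) ∧
  IntervalIntegrable (fun t => 𝓕.variationIntegrand p (Γ 0) t (variationField Γ t)) volume a b ∧
  HasDerivAt (fun s => ∫ t in a..b, 𝓕.nrm (velocity (Γ s) t) (velocity (Γ s) t) ^ p)
    (p * (𝓕.momentum p (velocityWithin (Γ 0) (Iic b) b) (variationField Γ b)
      - 𝓕.momentum p (velocityWithin (Γ 0) (Ici a) a) (variationField Γ a)
      - (∑ t ∈ S, if a < t ∧ t < b then 𝓕.jump p (Γ 0) t (variationField Γ t) else 0)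
      - ∫ t in a..b, 𝓕.variationIntegrand p (Γ 0) t (variationField Γ t))) 0

theorem hasFirstVariationOn_of_contMDiffOn {x₀ x₁ : M} (hp : p ≠ 0) (hε : 0 < ε) (ha : 0 ≤ a)
    (hab : a < b) (hb : b ≤ 1)
    (hG : ContMDiffOn 𝓘(ℝ, ℝ × ℝ) (𝓡 n) ∞ (fun q : ℝ × ℝ => Γ q.1 q.2)
      (Ioo (-ε) ε ×ˢ Icc a b))
    (hadm : ∀ s ∈ Ioo (-ε) ε, IsAdmissible n x₀ x₁ (Γ s)) {S : Finset ℝ}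
    (hS : Disjoint (Ioo a b) (S : Set ℝ)) : HasFirstVariationOn 𝓕 p Γ ε S a b := by
  have h0 : (0 : ℝ) ∈ Ioo (-ε) ε := ⟨by linarith, hε⟩
  have hreg : ∀ q ∈ Ioo (-ε) ε ×ˢ Icc a b, mfderivWithin 𝓘(ℝ, ℝ × ℝ) (𝓡 n)
      (fun q : ℝ × ℝ => Γ q.1 q.2) (Ioo (-ε) ε ×ˢ Icc a b) q ((0 : ℝ), (1 : ℝ)) ≠ 0 :=
    fun q hq => IsAdmissible.mfderivWithin_ne_zero ha hab hb hG hq.1 (hadm _ hq.1) hq.2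
  have hl := 𝓕.contDiffOn_F_mfderivWithin hab hG hreg p
  set l : ℝ × ℝ → ℝ := fun q => 𝓕.F ⟨Γ q.1 q.2, mfderivWithin 𝓘(ℝ, ℝ × ℝ) (𝓡 n)
      (fun q : ℝ × ℝ => Γ q.1 q.2) (Ioo (-ε) ε ×ˢ Icc a b) q ((0 : ℝ), (1 : ℝ))⟩ ^ p with hl'
  have hvel : ∀ s ∈ Ioo (-ε) ε, ∀ t ∈ Ioo a b, velocity (Γ s) t =
      mfderivWithin 𝓘(ℝ, ℝ × ℝ) (𝓡 n) (fun q : ℝ × ℝ => Γ q.1 q.2)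
        (Ioo (-ε) ε ×ˢ Icc a b) (s, t) ((0 : ℝ), (1 : ℝ)) :=
    fun s hs t ht => velocity_slice hG hs ht
  have hnrm : ∀ s ∈ Ioo (-ε) ε, ∀ t ∈ Ioo a b,
      l (s, t) = 𝓕.nrm (velocity (Γ s) t) (velocity (Γ s) t) ^ p := by
    intro s hs t ht
    rw [hvel s hs t ht, 𝓕.nrm_eq_F (hreg (s, t) ⟨hs, Ioo_subset_Icc_self ht⟩)]
  have hX : ∀ t ∈ Icc a b, variationField Γ t =
      mfderivWithin 𝓘(ℝ, ℝ × ℝ) (𝓡 n) (fun q : ℝ × ℝ => Γ q.1 q.2)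
        (Ioo (-ε) ε ×ˢ Icc a b) (0, t) ((1 : ℝ), (0 : ℝ)) :=
    fun t ht => variationField_slice hε hG ht
  obtain ⟨hj, hder⟩ := hasDerivAt_integral_of_hasDerivAt_momentum hε hab hl
    (j := fun t => 𝓕.variationIntegrand p (Γ 0) t (variationField Γ t)) hp
    (𝓕.contDiffOn_momentum hε hab hG hreg p) fun t ht => by
      rw [hX t (Ioo_subset_Icc_self ht)]
      exact 𝓕.hasDerivAt_momentum hε hG hreg p ht
  refine ⟨fun s hs => ?_, hj, ?_⟩
  · have hc : ContinuousOn (fun t => l (s, t)) (Icc a b) :=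
      hl.continuousOn.comp (by fun_prop) fun t ht => ⟨hs, ht⟩
    have hi : IntervalIntegrable (fun t => l (s, t)) volume a b :=
      ContinuousOn.intervalIntegrable (by rwa [uIcc_of_le hab.le])
    rw [intervalIntegrable_iff_integrableOn_Ioo_of_le hab.le] at hi ⊢
    exact hi.congr_fun (fun t ht => hnrm s hs t ht) measurableSet_Ioo
  · refine (hder.congr_of_eventuallyEq ?_).congr_deriv ?_
    · filter_upwards [isOpen_Ioo.mem_nhds h0] with s hs
      -- The two-sided `velocity` is identified only inside the piece; the end points form a null
      -- set.
      rw [intervalIntegral.integral_of_le hab.le, intervalIntegral.integral_of_le hab.le,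
        integral_Ioc_eq_integral_Ioo, integral_Ioc_eq_integral_Ioo]
      exact setIntegral_congr_fun measurableSet_Ioo fun t ht => (hnrm s hs t ht).symm
    · have hva : velocityWithin (Γ 0) (Ici a) a = mfderivWithin 𝓘(ℝ, ℝ × ℝ) (𝓡 n)
          (fun q : ℝ × ℝ => Γ q.1 q.2) (Ioo (-ε) ε ×ˢ Icc a b) (0, a) ((0 : ℝ), (1 : ℝ)) :=
        velocityWithin_slice hG h0 (left_mem_Icc.2 hab.le) (Icc_mem_nhdsGE hab)
          (uniqueDiffOn_Ici a a self_mem_Ici)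
      have hvb : velocityWithin (Γ 0) (Iic b) b = mfderivWithin 𝓘(ℝ, ℝ × ℝ) (𝓡 n)
          (fun q : ℝ × ℝ => Γ q.1 q.2) (Ioo (-ε) ε ×ˢ Icc a b) (0, b) ((0 : ℝ), (1 : ℝ)) :=
        velocityWithin_slice hG h0 (right_mem_Icc.2 hab.le) (Icc_mem_nhdsLE hab)
          (uniqueDiffOn_Iic b b self_mem_Iic)
      have hsum : (∑ t ∈ S, if a < t ∧ t < b then 𝓕.jump p (Γ 0) t (variationField Γ t) else 0)
          = 0 :=
        Finset.sum_eq_zero fun t ht => if_neg fun h => Set.disjoint_left.1 hS h ht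
      rw [hsum, hva, hvb, hX a (left_mem_Icc.2 hab.le), hX b (right_mem_Icc.2 hab.le)]
      ring

theorem HasFirstVariationOn.trans {𝓕 : FinslerMetric n M} {p : ℝ} {Γ : ℝ → ℝ → M} (hε : 0 < ε)
    {S : Finset ℝ} {a b c : ℝ} (hc : c ∈ S) (hac : a < c) (hcb : c < b)
    (h₁ : HasFirstVariationOn 𝓕 p Γ ε S a c) (h₂ : HasFirstVariationOn 𝓕 p Γ ε S c b) :
    HasFirstVariationOn 𝓕 p Γ ε S a b := by
  obtain ⟨h1, h1', h1''⟩ := h₁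
  obtain ⟨h2, h2', h2''⟩ := h₂
  refine ⟨fun s hs => (h1 s hs).trans (h2 s hs), h1'.trans h2', ?_⟩
  refine ((h1''.add h2'').congr_of_eventuallyEq ?_).congr_deriv ?_
  · filter_upwards [isOpen_Ioo.mem_nhds (show (0 : ℝ) ∈ Ioo (-ε) ε from ⟨by linarith, hε⟩)]
      with s hs
    exact (intervalIntegral.integral_add_adjacent_intervals (h1 s hs) (h2 s hs)).symm
  · have hsum : (∑ t ∈ S, if a < t ∧ t < b then 𝓕.jump p (Γ 0) t (variationField Γ t) else 0)
        = (∑ t ∈ S, if a < t ∧ t < c then 𝓕.jump p (Γ 0) t (variationField Γ t) else 0)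
          + (∑ t ∈ S, if c < t ∧ t < b then 𝓕.jump p (Γ 0) t (variationField Γ t) else 0)
          + 𝓕.jump p (Γ 0) c (variationField Γ c) := by
      -- Written as a sum over S, the jump at c can be compared term by term, according to the
      -- position of t relative to c.
      have hone : 𝓕.jump p (Γ 0) c (variationField Γ c)
          = ∑ t ∈ S, if c = t then 𝓕.jump p (Γ 0) t (variationField Γ t) else 0 := by
        rw [Finset.sum_ite_eq, if_pos hc]
      rw [hone, ← Finset.sum_add_distrib, ← Finset.sum_add_distrib]
      refine Finset.sum_congr rfl fun t _ => ?_
      rcases lt_trichotomy t c with h | h | h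
      · simp [h, h.trans hcb, h.ne', h.not_gt]
      · subst h
        simp [hac, hcb]
      · simp [h, hac.trans h, h.ne, h.not_gt]
    rw [hsum, ← intervalIntegral.integral_add_adjacent_intervals h1' h2', FinslerMetric.jump]
    ring

/-- A property of intervals which holds for those without a point of `S` in the interior, and
passes to unions of intervals adjacent at a point of `S`, holds for all intervals. -/
theorem interval_induction_of_finset {S : Finset ℝ} {P : ℝ → ℝ → Prop} {A B : ℝ}
    (base : ∀ a b, A ≤ a → a < b → b ≤ B → Disjoint (Ioo a b) (S : Set ℝ) → P a b)
    (trans : ∀ a c b, c ∈ S → a < c → c < b → P a c → P c b → P a b) {a b : ℝ}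
    (ha : A ≤ a) (hab : a < b) (hb : b ≤ B) : P a b := by
  induction hk : (S.filter (· ∈ Ioo a b)).card using Nat.strong_induction_on generalizing a b with
  | _ k ih =>
    by_cases hd : Disjoint (Ioo a b) (S : Set ℝ)
    · exact base a b ha hab hb hd
    · obtain ⟨c, hc, hcS⟩ := Set.not_disjoint_iff.1 hd
      -- The point c is counted for (a, b) but for neither of the two subintervals, so the number of
      -- break points drops.
      have hlt : ∀ a' b', a ≤ a' → b' ≤ b → c ∉ Ioo a' b' →
          (S.filter (· ∈ Ioo a' b')).card < k := by
        intro a' b' ha' hb' hc'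
        rw [← hk]
        refine Finset.card_lt_card ⟨fun t ht => ?_, fun hsub => hc' ?_⟩
        · rw [Finset.mem_filter] at ht ⊢
          exact ⟨ht.1, Ioo_subset_Ioo ha' hb' ht.2⟩
        · exact (Finset.mem_filter.1 (hsub (Finset.mem_filter.2 ⟨hcS, hc⟩))).2
      exact trans a c b hcS hc.1 hc.2
        (ih _ (hlt a c le_rfl hc.2.le fun h => h.2.false) ha hc.1 (hc.2.le.trans hb) rfl)
        (ih _ (hlt c b hc.1.le le_rfl fun h => h.1.false) (ha.trans hc.1.le) hc.2 hb rfl)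

theorem FinslerMetric.momentum_zero {x : M} (y : TangentSpace (𝓡 n) x) :
    𝓕.momentum p y 0 = 0 := by
  simp [FinslerMetric.momentum, FinslerMetric.g, fundTensor]

end Pieces

end FinslerVariation

/-! ### The first variation formula -/

theorem mainTheorem1 {n : ℕ} {M : Type*} [TopologicalSpace M]
    [ChartedSpace (EuclideanSpace ℝ (Fin n)) M] [IsManifold (𝓡 n) ∞ M]
    [T2Space M] [SecondCountableTopology M] [ConnectedSpace M]
    (𝓕 : FinslerVariation.FinslerMetric n M) (p : ℝ) (hp : p ≠ 0) (x₀ x₁ : M)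
    (ε : ℝ) (hε : 0 < ε) (Γ : ℝ → ℝ → M)
    (hΓ : FinslerVariation.IsVariation n x₀ x₁ ε Γ) :
    (∀ s ∈ Ioo (-ε) ε, IntervalIntegrable
      (fun t => 𝓕.nrm (FinslerVariation.velocity (Γ s) t) (FinslerVariation.velocity (Γ s) t) ^ p)
      volume 0 1) ∧
    IntervalIntegrable
      (fun t => 𝓕.variationIntegrand p (Γ 0) t (FinslerVariation.variationField Γ t))
      volume 0 1 ∧
    (FinslerVariation.breakPoints n (Γ 0)).Finite ∧
    DifferentiableAt ℝ (fun s => 𝓕.energy p (Γ s)) 0 ∧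
    (1 / p) * deriv (fun s => 𝓕.energy p (Γ s)) 0 =
      -(∑ᶠ t ∈ FinslerVariation.breakPoints n (Γ 0),
          𝓕.jump p (Γ 0) t (FinslerVariation.variationField Γ t))
      - ∫ t in (0 : ℝ)..1,
          𝓕.variationIntegrand p (Γ 0) t (FinslerVariation.variationField Γ t) := by
  open FinslerVariation in
  obtain ⟨hadm, S, hS01, hS⟩ := hΓ
  obtain ⟨hint, hint', hder⟩ : HasFirstVariationOn 𝓕 p Γ ε S 0 1 :=
    interval_induction_of_finset (A := 0) (B := 1)
      (fun a b ha hab hb hd =>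
        hasFirstVariationOn_of_contMDiffOn 𝓕 p Γ hp hε ha hab hb (hS a b ha hab hb hd) hadm hd)
      (fun a c b hc hac hcb h₁ h₂ => h₁.trans hε hc hac hcb h₂) le_rfl one_pos le_rfl
  have hsub : breakPoints n (Γ 0) ⊆ S := fun t ht => by
    by_contra htS
    exact ht.2 (velocityWithin_Ici_eq_Iic hε hS ht.1 htS)
  have hfin : (breakPoints n (Γ 0)).Finite := S.finite_toSet.subset hsub
  have hX0 : variationField (n := n) Γ 0 = 0 :=
    variationField_eq_zero hε fun s hs => (hadm s hs).1
  have hX1 : variationField (n := n) Γ 1 = 0 :=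
    variationField_eq_zero hε fun s hs => (hadm s hs).2.1
  -- S may contain points where the velocity is continuous; there the two momenta coincide and the
  -- jump is zero.
  have hsum : ∑ᶠ t ∈ breakPoints n (Γ 0), 𝓕.jump p (Γ 0) t (variationField Γ t)
      = ∑ t ∈ S, if 0 < t ∧ t < 1 then 𝓕.jump p (Γ 0) t (variationField Γ t) else 0 := by
    rw [finsum_mem_eq_finite_toFinset_sum _ hfin]
    have hS' : (∑ t ∈ S, if 0 < t ∧ t < 1 then 𝓕.jump p (Γ 0) t (variationField Γ t) else 0)
        = ∑ t ∈ S, 𝓕.jump p (Γ 0) t (variationField Γ t) :=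
      Finset.sum_congr rfl fun t ht => if_pos (hS01 ht)
    rw [hS']
    refine Finset.sum_subset (fun t ht => hsub (hfin.mem_toFinset.1 ht)) fun t htS ht => ?_
    rw [hfin.mem_toFinset] at ht
    have hv : velocityWithin (n := n) (Γ 0) (Ici t) t = velocityWithin (Γ 0) (Iic t) t := by
      by_contra hne
      exact ht ⟨hS01 htS, hne⟩
    rw [FinslerMetric.jump, hv, sub_self]
  -- The end points of the curves are fixed, so X vanishes at 0 and 1 and the outer boundary terms
  -- disappear.
  rw [hX0, hX1, 𝓕.momentum_zero, 𝓕.momentum_zero, ← hsum] at hder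
  refine ⟨hint, hint', hfin, hder.differentiableAt, ?_⟩
  have hd : deriv (fun s => 𝓕.energy p (Γ s)) 0 = _ := hder.deriv
  rw [hd]
  field_simp
  ring
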